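/- Let $\mathbb{F}_q$ be a finite field with $q$ odd, let $g\ge 0$ be an integer, and let $D\in\mathbb{F}_q[x]$ be monic and square-free of degree $2g+1$. Let $C_D$ be the smooth projective model, of genus $g$, of the curve $y^2=D(x)$, let $N_n$ be the number of its points over $\mathbb{F}_{q^n}$, and let $P_{C_D}$ be the numerator of its zeta function, i.e. the polynomial with integer coefficients such that $$\exp\Big(\sum_{n\ge1}N_n\frac{u^n}{n}\Big)=\frac{P_{C_D}(u)}{(1-u)(1-qu)}\qquad(u\in\mathbb{C},\ |u|<1/q).$$ For monic irreducible $P\in\mathbb{F}_q[x]$ let $\chi_D(P)$ be $0$ if $P\mid D$, $1$ if $P\nmid D$ and $D$ is a square modulo $P$, and $-1$ otherwise; extend $\chi_D$ completely multiplicatively to all monic $f$ (so $\chi_D(f)$ is the Jacobi symbol $(D/f)$). Let $\mathcal{L}(u,\chi_D)$ be the polynomial with integer coefficients such that $$\mathcal{L}(u,\chi_D)=\prod_{P\text{ monic irreducible}}\big(1-\chi_D(P)u^{\deg P}\big)^{-1}\qquad(u\in\mathbb{C},\ |u|<1/q).$$ Then the polynomials $P_{C_D}$ and $\mathcal{L}(\cdot,\chi_D)$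 exist and are unique (the series and the product being convergent for $|u|<1/q$), and $$P_{C_D}(q^{-1/2})=\mathcal{L}(q^{-1/2},\chi_D)=\sum_{n=0}^{g}\ \sum_{\substack{f\text{ monic}\\ \deg f=n}}\chi_D(f)\,q^{-n/2}+\sum_{m=0}^{g-1}\ \sum_{\substack{f\text{ monic}\\ \deg f=m}}\chi_D(f)\,q^{-m/2},$$ where the last sum is empty if $g=0$. -/

import Mathlib

open Polynomial

namespace HyperellipticL

noncomputable section

/-- The monic square-free polynomials of degree `2 * g + 1` over `F`. -/
def ensemble (F : Type*) [Field F] (g : ℕ) : Set F[X] :=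
  {D | D.Monic ∧ D.natDegree = 2 * g + 1 ∧ Squarefree D}

/-! ### The hyperelliptic curve `y ^ 2 = D(x)` and its zeta function -/

/-- The degree `2 * g + 2` homogenization of `D`, evaluated at `(X, Z)` in an extension `K`. -/
def homogEval {F : Type*} [Field F] (g : ℕ) (D : F[X]) (K : Type*) [Field K] [Algebra F K]
    (X Z : K) : K :=
  ∑ i ∈ Finset.range (2 * g + 3), algebraMap F K (D.coeff i) * X ^ i * Z ^ (2 * g + 2 - i)

/-- The nonzero triples `(X, Y, Z)` over `K` that satisfy the weighted homogeneous equation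
`Y ^ 2 = Z ^ (2 * g + 2) * D(X / Z)`. -/
def CurveTriple {F : Type*} [Field F] (g : ℕ) (D : F[X]) (K : Type*) [Field K] [Algebra F K] :
    Type _ :=
  {v : K × K × K // v ≠ 0 ∧ v.2.1 ^ 2 = homogEval g D K v.1 v.2.2}

/-- Proportionality in the weighted projective plane with weights `(1, g + 1, 1)`. -/
def curveSetoid {F : Type*} [Field F] (g : ℕ) (D : F[X]) (K : Type*) [Field K] [Algebra F K] :
    Setoid (CurveTriple g D K) where
  r v w := ∃ t : K, t ≠ 0 ∧ w.1 = (t * v.1.1, t ^ (g + 1) * v.1.2.1, t * v.1.2.2)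
  iseqv :=
    { refl := fun v => ⟨1, one_ne_zero, by simp⟩
      symm := by
        rintro v w ⟨t, ht, h⟩
        refine ⟨t⁻¹, inv_ne_zero ht, ?_⟩
        rw [h]
        simp [ht]
      trans := by
        rintro u v w ⟨s, hs, h⟩ ⟨t, ht, h'⟩
        refine ⟨t * s, mul_ne_zero ht hs, ?_⟩
        rw [h', h]
        simp [mul_pow, mul_assoc] }

/-- The `K`-rational points of the curve `C_D`: for `D` square-free of degree `2 * g + 1` and odd
characteristic, the smooth projective model of `y ^ 2 = D(x)`, of genus `g`, is the curve
`Y ^ 2 = Z ^ (2 * g + 2) * D(X / Z)` in the weighted projective plane with weights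
`(1, g + 1, 1)`. -/
def CurvePoint {F : Type*} [Field F] (g : ℕ) (D : F[X]) (K : Type*) [Field K] [Algebra F K] :
    Type _ :=
  Quotient (curveSetoid g D K)

/-- The number `N_n` of points of `C_D` over the extension of degree `n` of the finite
field `F`. -/
def pointCount {F : Type*} [Field F] [Finite F] (g : ℕ) (D : F[X]) (n : ℕ) [NeZero n] : ℕ :=
  haveI : Fact (ringChar F).Prime := ⟨CharP.char_is_prime F (ringChar F)⟩
  Nat.card (CurvePoint g D (FiniteField.Extension F (ringChar F) n))

/-- The `n`-th term, `n ≥ 1` shifted to `n + 1`, of the series `∑ N_n u ^ n / n`. -/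
def zetaTerm {F : Type*} [Field F] [Finite F] (g : ℕ) (D : F[X]) (u : ℂ) (n : ℕ) : ℂ :=
  (pointCount g D (n + 1) : ℂ) * u ^ (n + 1) / ((n + 1 : ℕ) : ℂ)

/-- `P` is the numerator of the zeta function of `C_D`: for `|u| < 1 / q` the series defining
`Z(u) = exp (∑ N_n u ^ n / n)` converges, and `Z(u) = P(u) / ((1 - u) * (1 - q * u))`. -/
def IsZetaNumerator {F : Type*} [Field F] [Finite F] (g : ℕ) (D : F[X]) (P : ℤ[X]) : Prop :=
  ∀ u : ℂ, ‖u‖ < 1 / (Nat.card F : ℝ) →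
    Summable (zetaTerm g D u) ∧
    Complex.exp (∑' n, zetaTerm g D u n) = aeval u P / ((1 - u) * (1 - (Nat.card F : ℂ) * u))

/-! ### The quadratic character `χ_D` and its `L`-function -/

open scoped Classical in
/-- The quadratic residue symbol `(a / P)`, for `P` irreducible. -/
def residueSymbol {F : Type*} [Field F] (a P : F[X]) : ℤ :=
  if P ∣ a then 0 else if ∃ b : F[X], P ∣ b ^ 2 - a then 1 else -1

open scoped Classical in
/-- `χ_D(f) = (D / f)`, the Jacobi symbol: the product of the residue symbols `(D / P)` over the
monic irreducible factors `P` of `f`, with multiplicity. It is used for nonzero `f` only. -/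
def chi {F : Type*} [Field F] (D f : F[X]) : ℤ :=
  ((UniqueFactorizationMonoid.normalizedFactors f).map (residueSymbol D)).prod

/-- `L` is the polynomial that continues the `L`-function of `χ_D`: for `|u| < 1 / q` the Euler
product of `(1 - χ_D(P) * u ^ deg P)⁻¹` over the monic irreducible `P` converges to `L(u)`. -/
def IsLPolynomial {F : Type*} [Field F] [Finite F] (D : F[X]) (L : ℤ[X]) : Prop :=
  ∀ u : ℂ, ‖u‖ < 1 / (Nat.card F : ℝ) →
    HasProd (fun P : {P : F[X] // P.Monic ∧ Irreducible P} =>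
      (1 - (chi D P.1 : ℂ) * u ^ P.1.natDegree)⁻¹) (aeval u L)

/-! ### Sums over monic polynomials of a given degree -/

theorem finite_monic_natDegree (F : Type*) [Field F] [Finite F] (n : ℕ) :
    {f : F[X] | f.Monic ∧ f.natDegree = n}.Finite := by
  apply Set.Finite.of_finite_image (f := fun f : F[X] => fun i : Fin (n + 1) => f.coeff i)
    (Set.toFinite _)
  intro f hf h hh e
  ext i
  by_cases hi : i < n + 1
  · exact congrFun e ⟨i, hi⟩
  · rw [coeff_eq_zero_of_natDegree_lt (by have := hf.2; omega),
      coeff_eq_zero_of_natDegree_lt (by have := hh.2; omega)]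

/-- The monic polynomials of degree `n` over the finite field `F`. -/
def monicOfDegree (F : Type*) [Field F] [Finite F] (n : ℕ) : Finset F[X] :=
  (finite_monic_natDegree F n).toFinset

end

end HyperellipticL

/-!
Write `q` for the number of elements of `F` and `A n` for the sum of `χ_D` over the monic
polynomials of degree `n` (`charSum`). Unique factorization turns the Euler product of `χ_D` into
the power series `∑ A n * u ^ n` (`hasProd_inv_one_sub`, `hasSum_charSum`).

By the reciprocity law `chi_reciprocity`, which rests on the symmetry of the resultant,
`(D / f)` differs from `(f / D)` by a sign that depends only on the degree of `f`. As a function of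
`f`, the symbol `(f / D)` is a character modulo `D`, and it is the quadratic character on the
constants because the degree of `D` is odd. Hence it sums to zero over any `F`-subspace, and
`A n = 0` for `n ≥ 2 * g + 1` (`charSum_eq_zero`): the power series is a polynomial `L`.

The functional equation `q ^ g * A k = q ^ k * A (2 * g - k)` (`charSum_symm`) is Poisson summation
on `F[X] / (D)` for the additive character `f ↦ ψ (res (f / D))`, under which the spaces of
polynomials of degree less than `k` and less than `2 * g + 1 - k` are orthogonal complements. It
yields `G * A k = q ^ k * τ * A (2 * g - k)`, where `G` and `τ` are the Gauss sums modulo `D` and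
over `F`. The sign of the functional equation comes from `G = q ^ g * τ`: since `D` is square-free,
`F[X] / (D)` is a product of fields, so `G` equals the quadratic Gauss sum `∑ ψ (res (x ^ 2 / D))`
(`sum_chi_mul_addChar`), and the form `res (x ^ 2 / D)` has a totally isotropic subspace of
dimension `g` whose orthogonal complement contributes only one further variable
(`sum_modChar_sq`).

On the geometric side, the curve has `q ^ n + 1 + ∑ η (D(x))` points over the extension `K` of
degree `n`, the sum being over `x` in `K` and `η` the quadratic character of `K`. Grouping the `x`
by their minimal polynomials turns this sum into the coefficient of `u ^ n / n` in the logarithm of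
the Euler product (`pointCount_eq`, `exists_hasSum_primePowerSum`). So the numerator of the zeta
function is the same polynomial `L`. At `u = q ^ (-1 / 2)` the functional equation identifies the
terms of degree above `g` with those of degree below `g` (`aeval_lPolynomial_central`).
-/

namespace HyperellipticL


/-! ### Quadratic characters of finite fields -/

open scoped Classical in
/-- The quadratic character of a field `K`, extended by `0` at `0`. For a finite field it is
Mathlib's `quadraticChar`; here no instance of finiteness or decidability enters the
definition. -/
noncomputable def quadChar (K : Type*) [Field K] (a : K) : ℤ :=
  if a = 0 then 0 else if IsSquare a then 1 else -1

section quadChar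

variable {K : Type*} [Field K]

theorem quadChar_eq [Fintype K] [DecidableEq K] (a : K) : quadChar K a = quadraticChar K a := by
  rw [quadraticChar_apply, quadraticCharFun, quadChar]
  congr

@[simp] theorem quadChar_zero : quadChar K 0 = 0 := by simp [quadChar]

@[simp] theorem quadChar_one : quadChar K 1 = 1 := by simp [quadChar]

theorem quadChar_eq_zero_iff {a : K} : quadChar K a = 0 ↔ a = 0 := by
  unfold quadChar
  split_ifs <;> simp_all

theorem quadChar_mul [Finite K] (a b : K) :
    quadChar K (a * b) = quadChar K a * quadChar K b := by
  classical
  have := Fintype.ofFinite K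
  simp only [quadChar_eq, map_mul]

theorem quadChar_pow [Finite K] (a : K) (n : ℕ) : quadChar K (a ^ n) = quadChar K a ^ n := by
  induction n with
  | zero => simp
  | succ n ih => rw [pow_succ, quadChar_mul, ih, pow_succ]

theorem quadChar_sq {a : K} (ha : a ≠ 0) : quadChar K a * quadChar K a = 1 := by
  unfold quadChar
  split_ifs <;> simp_all

theorem quadChar_neg_one_sq : quadChar K (-1) ^ 2 = 1 := by
  rw [pow_two, quadChar_sq (neg_ne_zero.mpr one_ne_zero)]

theorem ringChar_ne_two_of_odd [Finite K] (h : Odd (Nat.card K)) : ringChar K ≠ 2 := by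
  have := Fintype.ofFinite K
  rw [Ne, FiniteField.even_card_iff_char_two, ← Nat.card_eq_fintype_card]
  have := Nat.odd_iff.mp h
  omega

theorem exists_quadChar_eq_neg_one [Finite K] (h : Odd (Nat.card K)) :
    ∃ a : K, quadChar K a = -1 := by
  classical
  have := Fintype.ofFinite K
  obtain ⟨a, ha⟩ := quadraticChar_exists_neg_one (ringChar_ne_two_of_odd h)
  exact ⟨a, by rw [quadChar_eq, ha]⟩

theorem natCard_sqrt [Finite K] (h : Odd (Nat.card K)) (a : K) :
    (Nat.card {x : K // x ^ 2 = a} : ℤ) = 1 + quadChar K a := by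
  classical
  have := Fintype.ofFinite K
  rw [quadChar_eq, add_comm, ← quadraticChar_card_sqrts (ringChar_ne_two_of_odd h) a,
    Nat.card_eq_fintype_card, Set.toFinset_card]
  rfl

variable {L : Type*} [Field L] [Algebra K L] [Finite L]

/-- The quadratic character of a finite extension is that of the base field composed with
the norm: `x ^ ((q ^ n - 1) / 2) = (x ^ ((q ^ n - 1) / (q - 1))) ^ ((q - 1) / 2)`. -/
theorem quadChar_norm (h : Odd (Nat.card K)) (x : L) :
    quadChar K (Algebra.norm K x) = quadChar L x := by
  classical
  have : Finite K := Finite.of_injective _ (algebraMap K L).injective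
  have := Fintype.ofFinite K
  have := Fintype.ofFinite L
  have hK := ringChar_ne_two_of_odd h
  have : Module.Finite K L := Module.Finite.of_finite
  have hcard := Module.natCard_eq_pow_finrank (K := K) (V := L)
  have hL : ringChar L ≠ 2 := by
    apply ringChar_ne_two_of_odd
    rw [hcard]
    exact h.pow
  rcases eq_or_ne x 0 with rfl | hx
  · simp
  have hN : Algebra.norm K x ≠ 0 := Algebra.norm_ne_zero_iff.mpr hx
  have key : algebraMap K L (Algebra.norm K x ^ (Fintype.card K / 2)) =
      x ^ (Fintype.card L / 2) := by
    rw [map_pow, FiniteField.algebraMap_norm_eq_pow, ← pow_mul]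
    congr 1
    rw [← Nat.card_eq_fintype_card, ← Nat.card_eq_fintype_card, hcard]
    obtain ⟨k, hk⟩ := h
    obtain ⟨c, hc⟩ : Nat.card K - 1 ∣ Nat.card K ^ Module.finrank K L - 1 := by
      simpa using Nat.sub_dvd_pow_sub_pow (Nat.card K) 1 (Module.finrank K L)
    have h2 := Finite.one_lt_card (α := K)
    have h3 : 1 ≤ Nat.card K ^ Module.finrank K L := Nat.one_le_pow _ _ (by omega)
    rw [hc, Nat.mul_div_cancel_left _ (by omega)]
    have h4 : Nat.card K ^ Module.finrank K L = 2 * (k * c) + 1 := by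
      have : Nat.card K - 1 = 2 * k := by omega
      rw [this] at hc
      have h5 : Nat.card K ^ Module.finrank K L = 2 * k * c + 1 := by omega
      rw [h5]; ring
    have h6 : Nat.card K / 2 = k := by omega
    rw [h4, h6]
    rw [mul_comm c]
    omega
  have hsq : IsSquare (Algebra.norm K x) ↔ IsSquare x := by
    rw [FiniteField.isSquare_iff hK hN, FiniteField.isSquare_iff hL hx, ← key,
      map_eq_one_iff _ (algebraMap K L).injective]
  simp [quadChar, hx, hN, hsq]

theorem quadChar_algebraMap (h : Odd (Nat.card K)) (x : K) :
    quadChar L (algebraMap K L x) = quadChar K x ^ Module.finrank K L := by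
  have : Finite K := Finite.of_injective _ (algebraMap K L).injective
  rw [← quadChar_norm h, Algebra.norm_algebraMap, quadChar_pow]

end quadChar

/-! ### Gauss sums over a product of finite fields -/

section product

variable {ι : Type*} [Fintype ι] {K : ι → Type*} [∀ i, Field (K i)]

/-- The product of the quadratic characters of the factors of a finite product of fields. -/
noncomputable def piChar (x : ∀ i, K i) : ℤ := ∏ i, quadChar (K i) (x i)

@[simp] theorem piChar_one : piChar (1 : ∀ i, K i) = 1 := by simp [piChar]

theorem piChar_mul [∀ i, Finite (K i)] (x y : ∀ i, K i) :
    piChar (x * y) = piChar x * piChar y := by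
  simp [piChar, quadChar_mul, Finset.prod_mul_distrib]

theorem piChar_eq_zero_iff {x : ∀ i, K i} : piChar x = 0 ↔ ∃ i, x i = 0 := by
  simp [piChar, Finset.prod_eq_zero_iff, quadChar_eq_zero_iff]

theorem piChar_sq {x : ∀ i, K i} (hx : ∀ i, x i ≠ 0) : piChar x * piChar x = 1 := by
  simp [piChar, ← Finset.prod_mul_distrib, quadChar_sq (hx _)]

variable [Fintype (∀ i, K i)]

/-- The Gauss sum twisted by `b` is `piChar b` times the Gauss sum, also when `b` is not
a unit: then some unit `u` with `piChar u = -1` satisfies `u * b = b`. -/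
theorem sum_piChar_mul_shift [∀ i, Finite (K i)] (hodd : ∀ i, Odd (Nat.card (K i)))
    (Ψ : AddChar (∀ i, K i) ℂ) (b : ∀ i, K i) :
    ∑ a, (piChar a : ℂ) * Ψ (a * b) = piChar b * ∑ a, (piChar a : ℂ) * Ψ a := by
  classical
  -- the substitution `a ↦ u * a`
  have hscale (u : (∀ i, K i)ˣ) (c : ∀ i, K i) : ∑ a, (piChar a : ℂ) * Ψ (a * c) =
      piChar (u : ∀ i, K i) * ∑ a, (piChar a : ℂ) * Ψ (a * ((u : ∀ i, K i) * c)) := by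
    rw [← Equiv.sum_comp (Units.mulLeft u) fun a => (piChar a : ℂ) * Ψ (a * c), Finset.mul_sum]
    refine Finset.sum_congr rfl fun a _ => ?_
    rw [show Units.mulLeft u a = u * a from rfl, piChar_mul, Int.cast_mul,
      mul_assoc (piChar _ : ℂ), mul_comm (u : ∀ i, K i) a, mul_assoc a]
  by_cases hb : ∃ i, b i = 0
  · rw [piChar_eq_zero_iff.mpr hb]
    obtain ⟨i, hi⟩ := hb
    obtain ⟨r, hr⟩ := exists_quadChar_eq_neg_one (hodd i)
    have hr0 : r ≠ 0 := by rintro rfl; simp at hr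
    have hu : ∀ j, Function.update (1 : ∀ i, K i) i r j ≠ 0 := by
      intro j
      rcases eq_or_ne j i with rfl | h
      · simpa using hr0
      · simp [h]
    let u : (∀ i, K i)ˣ := MulEquiv.piUnits.symm fun j => Units.mk0 _ (hu j)
    have huv : (u : ∀ i, K i) = Function.update (1 : ∀ i, K i) i r := by
      ext j; rfl
    have hub : (u : ∀ i, K i) * b = b := by
      ext j
      rcases eq_or_ne j i with rfl | h
      · simp [hi]
      · simp [huv, h]
    have hχ : piChar (u : ∀ i, K i) = -1 := by
      rw [huv, piChar, Finset.prod_eq_single i]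
      · simpa using hr
      · intro j _ h; simp [h]
      · simp
    have := hscale u b
    rw [hub, hχ] at this
    push_cast at this ⊢
    linear_combination this / 2
  · push Not at hb
    let u : (∀ i, K i)ˣ := MulEquiv.piUnits.symm fun j => Units.mk0 _ (hb j)
    have hu : (u : ∀ i, K i) = b := by ext j; rfl
    have h := hscale u 1
    simp only [mul_one, hu] at h
    rw [h, ← mul_assoc, ← Int.cast_mul, piChar_sq hb, Int.cast_one, one_mul]

end product

theorem sum_quadChar_mul_addChar {K : Type*} [Field K] [Fintype K] (h : Odd (Nat.card K))
    {ψ : AddChar K ℂ} (hψ : ψ ≠ 1) :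
    ∑ a, (quadChar K a : ℂ) * ψ a = ∑ x, ψ (x ^ 2) := by
  classical
  rw [← Finset.sum_fiberwise Finset.univ (fun x : K => x ^ 2) fun x => ψ (x ^ 2)]
  have hfib (a : K) : ∑ x with x ^ 2 = a, ψ (x ^ 2) = (1 + (quadChar K a : ℂ)) * ψ a := by
    rw [Finset.sum_congr rfl (g := fun _ => ψ a)
      (fun x hx => by rw [(Finset.mem_filter.mp hx).2]), Finset.sum_const, nsmul_eq_mul]
    congr 1
    have := natCard_sqrt h a
    rw [Nat.card_eq_fintype_card, Fintype.card_subtype] at this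
    exact_mod_cast this
  simp_rw [hfib, add_mul, one_mul, Finset.sum_add_distrib,
    AddChar.sum_eq_zero_of_ne_one hψ, zero_add]

/-- The Gauss sum of `piChar` equals the quadratic Gauss sum: both factor over the fields
`K i`, and for a single field the number of square roots of `a` is `1 + quadChar a`. -/
theorem sum_piChar_mul_addChar {ι : Type*} [Fintype ι] {K : ι → Type*} [∀ i, Field (K i)]
    [Fintype (∀ i, K i)] [∀ i, Finite (K i)] (hodd : ∀ i, Odd (Nat.card (K i)))
    (Ψ : AddChar (∀ i, K i) ℂ) (hΨ : ∀ i, ∃ y, (∀ j, j ≠ i → y j = 0) ∧ Ψ y ≠ 1) :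
    ∑ a, (piChar a : ℂ) * Ψ a = ∑ x, Ψ (x ^ 2) := by
  classical
  have := fun i => Fintype.ofFinite (K i)
  let ψ (i : ι) : AddChar (K i) ℂ := Ψ.compAddMonoidHom (AddMonoidHom.single K i)
  have hψ (i : ι) : ψ i ≠ 1 := by
    obtain ⟨y, hy, h1⟩ := hΨ i
    intro h
    apply h1
    have hs : y = Pi.single i (y i) := by
      ext j
      rcases eq_or_ne j i with rfl | hj
      · simp
      · simp [hj, hy j hj]
    have h2 := DFunLike.congr_fun h (y i)
    rw [hs]
    simpa [ψ] using h2
  have hprod (x : ∀ i, K i) : Ψ x = ∏ i, ψ i (x i) := by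
    conv_lhs => rw [← Finset.univ_sum_single x]
    have h := map_prod Ψ.toMonoidHom (fun i => Multiplicative.ofAdd (Pi.single i (x i))) Finset.univ
    rw [← ofAdd_sum] at h
    exact h
  have hsplit (f : ∀ i, K i → ℂ) : ∑ x : ∀ i, K i, ∏ i, f i (x i) = ∏ i, ∑ c, f i c := by
    rw [Finset.prod_univ_sum, Fintype.piFinset_univ]
    exact Finset.sum_congr (by ext; simp) fun _ _ => rfl
  simp_rw [hprod, piChar, Int.cast_prod, ← Finset.prod_mul_distrib, Pi.pow_apply]
  rw [hsplit (fun i c => (quadChar (K i) c : ℂ) * ψ i c), hsplit (fun i c => ψ i (c ^ 2))]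
  exact Finset.prod_congr rfl fun i _ => sum_quadChar_mul_addChar (hodd i) (hψ i)


/-! ### Sums over polynomials of bounded degree -/

section polysLT

variable {F : Type*} [Field F] [Finite F]

theorem finite_degree_lt (F : Type*) [Field F] [Finite F] (n : ℕ) :
    {f : F[X] | f.degree < n}.Finite := by
  have : Finite (degreeLT F n) := Finite.of_equiv _ (degreeLTEquiv F n).symm.toEquiv
  refine (Set.toFinite (degreeLT F n : Set F[X])).subset fun f hf => ?_
  exact mem_degreeLT.mpr hf

/-- The polynomials of degree less than `n` over the finite field `F`. -/
noncomputable def polysLT (F : Type*) [Field F] [Finite F] (n : ℕ) : Finset F[X] :=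
  (finite_degree_lt F n).toFinset

@[simp] theorem mem_polysLT {n : ℕ} {f : F[X]} : f ∈ polysLT F n ↔ f.degree < n := by
  simp [polysLT]

@[simp] theorem mem_monicOfDegree {n : ℕ} {f : F[X]} :
    f ∈ monicOfDegree F n ↔ f.Monic ∧ f.natDegree = n := by
  simp [monicOfDegree]

theorem polysLT_zero : polysLT F 0 = {0} := by
  ext f
  simp

variable {M : Type*} [AddCommMonoid M]

theorem sum_polysLT_add {n : ℕ} {v : F[X]} (hv : v.degree < n) (h : F[X] → M) :
    ∑ f ∈ polysLT F n, h (v + f) = ∑ f ∈ polysLT F n, h f := by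
  refine Finset.sum_nbij' (fun f => v + f) (fun f => f - v) ?_ ?_ ?_ ?_ ?_
  · intro f hf
    exact mem_polysLT.mpr ((degree_add_le _ _).trans_lt (max_lt hv (mem_polysLT.mp hf)))
  · intro f hf
    exact mem_polysLT.mpr ((degree_sub_le _ _).trans_lt (max_lt (mem_polysLT.mp hf) hv))
  · simp
  · simp
  · simp

theorem sum_polysLT_C_mul {n : ℕ} {c : F} (hc : c ≠ 0) (h : F[X] → M) :
    ∑ f ∈ polysLT F n, h (C c * f) = ∑ f ∈ polysLT F n, h f := by
  refine Finset.sum_nbij' (fun f => C c * f) (fun f => C c⁻¹ * f) ?_ ?_ ?_ ?_ ?_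
  · intro f hf
    simpa [degree_C_mul hc] using hf
  · intro f hf
    simpa [degree_C_mul (inv_ne_zero hc)] using hf
  · intro f _
    simp [← mul_assoc, ← C_mul, hc]
  · intro f _
    simp [← mul_assoc, ← C_mul, hc]
  · simp

theorem sum_polysLT_succ [Fintype F] (n : ℕ) (h : F[X] → M) :
    ∑ f ∈ polysLT F (n + 1), h f = ∑ c : F, ∑ v ∈ polysLT F n, h (C c * X ^ n + v) := by
  rw [← Finset.sum_product']
  symm
  refine Finset.sum_nbij' (fun p => C p.1 * X ^ n + p.2)
    (fun f => (f.coeff n, f - C (f.coeff n) * X ^ n)) ?_ ?_ ?_ ?_ ?_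
  · rintro ⟨c, v⟩ hv
    have hv : v.degree < n := by simpa using hv
    refine mem_polysLT.mpr ((degree_add_le _ _).trans_lt (max_lt ?_ ?_))
    · exact (degree_C_mul_X_pow_le _ _).trans_lt (by exact_mod_cast n.lt_succ_self)
    · exact hv.trans (by exact_mod_cast n.lt_succ_self)
  · intro f hf
    have hf : f.degree < ((n + 1 : ℕ) : WithBot ℕ) := by simpa using hf
    simp only [Finset.mem_product, Finset.mem_univ, true_and, mem_polysLT]
    rw [degree_lt_iff_coeff_zero] at hf ⊢
    intro k hk
    rcases hk.eq_or_lt with rfl | hk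
    · simp
    · simp [coeff_X_pow, hk.ne', hf k hk]
  · rintro ⟨c, v⟩ hv
    have hv : v.degree < n := by simpa using hv
    have : v.coeff n = 0 := coeff_eq_zero_of_degree_lt hv
    simp [this]
  · simp
  · simp

theorem sum_monicOfDegree (n : ℕ) (h : F[X] → M) :
    ∑ f ∈ monicOfDegree F n, h f = ∑ v ∈ polysLT F n, h (X ^ n + v) := by
  symm
  refine Finset.sum_nbij' (fun v => X ^ n + v) (fun f => f - X ^ n) ?_ ?_ ?_ ?_ ?_
  · intro v hv
    rw [mem_polysLT] at hv
    refine mem_monicOfDegree.mpr ⟨monic_X_pow_add hv, ?_⟩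
    rw [natDegree_add_eq_left_of_degree_lt (by simpa using hv), natDegree_X_pow]
  · intro f hf
    rw [mem_monicOfDegree] at hf
    rw [mem_polysLT]
    rcases eq_or_ne n 0 with rfl | hn
    · simp [hf.1.natDegree_eq_zero.mp hf.2]
    · have := hf.1.ne_zero
      have hd : f.degree = n := by rw [degree_eq_natDegree this, hf.2]
      rw [← hd]
      exact degree_sub_lt_left (by simp [hd]) this (by simp [hf.1.leadingCoeff])
  · simp
  · simp
  · simp

theorem card_polysLT (n : ℕ) : (polysLT F n).card = Nat.card F ^ n := by
  have := Fintype.ofFinite F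
  induction n with
  | zero => simp [polysLT_zero]
  | succ n ih =>
    rw [Finset.card_eq_sum_ones, sum_polysLT_succ]
    simp [ih, Nat.card_eq_fintype_card, pow_succ, mul_comm]

theorem card_monicOfDegree (n : ℕ) : (monicOfDegree F n).card = Nat.card F ^ n := by
  rw [← card_polysLT, Finset.card_eq_sum_ones, sum_monicOfDegree, Finset.card_eq_sum_ones]

/-- Orthogonality for an additive character on the polynomials of degree less than `n`. -/
theorem sum_polysLT_addChar_eq_zero {n : ℕ} (θ : AddChar F[X] ℂ) {v : F[X]} (hv : v.degree < n)
    (h : θ v ≠ 1) : ∑ f ∈ polysLT F n, θ f = 0 := by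
  have := sum_polysLT_add hv θ
  simp_rw [AddChar.map_add_eq_mul, ← Finset.mul_sum] at this
  have h0 : (θ v - 1) * ∑ f ∈ polysLT F n, θ f = 0 := by linear_combination this
  exact (mul_eq_zero.mp h0).resolve_left (sub_ne_zero.mpr h)

end polysLT

/-! ### Residue symbols -/

section residueSymbol

variable {F : Type*} [Field F]

theorem residueSymbol_eq (a P : F[X]) [Fact (Irreducible P)] :
    residueSymbol a P = quadChar (AdjoinRoot P) (AdjoinRoot.mk P a) := by
  unfold residueSymbol quadChar
  rw [AdjoinRoot.mk_eq_zero]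
  congr 2
  rw [isSquare_iff_exists_sq, AdjoinRoot.mk_surjective.exists]
  simp_rw [eq_comm (a := AdjoinRoot.mk P a), ← map_pow, AdjoinRoot.mk_eq_mk]

theorem finite_adjoinRoot [Finite F] {P : F[X]} (hP : P ≠ 0) : Finite (AdjoinRoot P) :=
  have := (AdjoinRoot.powerBasis hP).finite
  Module.finite_of_finite F

theorem finrank_adjoinRoot {P : F[X]} (hP : P ≠ 0) :
    Module.finrank F (AdjoinRoot P) = P.natDegree := by
  rw [(AdjoinRoot.powerBasis hP).finrank, AdjoinRoot.powerBasis_dim]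

theorem natCard_adjoinRoot [Finite F] {P : F[X]} (hP : P ≠ 0) :
    Nat.card (AdjoinRoot P) = Nat.card F ^ P.natDegree := by
  have := (AdjoinRoot.powerBasis hP).finite
  rw [Module.natCard_eq_pow_finrank (K := F), finrank_adjoinRoot hP]

theorem residueSymbol_mul [Finite F] {P : F[X]} (hP : Irreducible P) (a b : F[X]) :
    residueSymbol (a * b) P = residueSymbol a P * residueSymbol b P := by
  have : Fact (Irreducible P) := ⟨hP⟩
  have := finite_adjoinRoot hP.ne_zero
  simp only [residueSymbol_eq, map_mul, quadChar_mul]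

theorem residueSymbol_C [Finite F] (h : Odd (Nat.card F)) {P : F[X]} (hP : Irreducible P)
    (c : F) : residueSymbol (C c) P = quadChar F c ^ P.natDegree := by
  have : Fact (Irreducible P) := ⟨hP⟩
  have := finite_adjoinRoot hP.ne_zero
  rw [residueSymbol_eq, AdjoinRoot.mk_C, ← AdjoinRoot.algebraMap_eq,
    quadChar_algebraMap h, finrank_adjoinRoot hP.ne_zero]

/-- The norm from `F[X] / (P)` of the class of `f` is the resultant of `P` and `f`: both are the
product of the values of `f` at the roots of `P`. -/
theorem norm_mk_eq_resultant [PerfectField F] {P : F[X]} (hP : Irreducible P) (hm : P.Monic)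
    (f : F[X]) : Algebra.norm F (AdjoinRoot.mk P f) = resultant P f := by
  classical
  have : Fact (Irreducible P) := ⟨hP⟩
  have := (AdjoinRoot.powerBasis hP.ne_zero).finite
  let E := AlgebraicClosure F
  apply (algebraMap F E).injective
  have hsep : (P.aroots E).Nodup := 
    nodup_roots (PerfectField.separable_of_irreducible hP).map
  rw [Algebra.norm_eq_prod_embeddings F E, ← resultant_map_map]
  have h1 : P.natDegree = (P.map (algebraMap F E)).natDegree := by simp
  rw [h1, resultant_eq_prod_eval _ _ _ natDegree_map_le (IsAlgClosed.splits _)]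
  rw [(hm.map _).leadingCoeff, one_pow, one_mul]
  have hσ (σ : AdjoinRoot P →ₐ[F] E) : σ (AdjoinRoot.mk P f) =
      eval (AdjoinRoot.equiv E F P hP.ne_zero σ : E) (f.map (algebraMap F E)) := by
    rw [← AdjoinRoot.aeval_eq, ← aeval_algHom_apply, aeval_def, eval_map]
    simp [AdjoinRoot.equiv]
  simp_rw [hσ]
  rw [Equiv.prod_comp (AdjoinRoot.equiv E F P hP.ne_zero)
      fun x => eval (x : E) (f.map (algebraMap F E)),
    ← Finset.prod_subtype (P.aroots E).toFinset (by simp)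
      fun x => eval x (f.map (algebraMap F E)),
    Finset.prod_eq_multiset_prod, Multiset.toFinset_val, hsep.dedup]

theorem residueSymbol_eq_resultant [Finite F] (h : Odd (Nat.card F)) {P : F[X]}
    (hP : Irreducible P) (hm : P.Monic) (f : F[X]) :
    residueSymbol f P = quadChar F (resultant P f) := by
  have : Fact (Irreducible P) := ⟨hP⟩
  have := finite_adjoinRoot hP.ne_zero
  rw [residueSymbol_eq, ← quadChar_norm h, norm_mk_eq_resultant hP hm]

theorem residueSymbol_reciprocity [Finite F] (h : Odd (Nat.card F)) {P Q : F[X]}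
    (hP : Irreducible P) (hPm : P.Monic) (hQ : Irreducible Q) (hQm : Q.Monic) :
    residueSymbol Q P = quadChar F (-1) ^ (P.natDegree * Q.natDegree) * residueSymbol P Q := by
  rw [residueSymbol_eq_resultant h hP hPm, residueSymbol_eq_resultant h hQ hQm, resultant_comm,
    quadChar_mul, quadChar_pow]

end residueSymbol


/-! ### The Jacobi symbol and its reciprocity law -/

section jacobi

open UniqueFactorizationMonoid

variable {F : Type*} [Field F]

open scoped Classical in
/-- The monic irreducible factors of `f ≠ 0`, with multiplicity. -/
noncomputable def monicFactors (f : F[X]) : Multiset F[X] := normalizedFactors f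

theorem chi_def (D f : F[X]) : chi D f = ((monicFactors f).map (residueSymbol D)).prod := rfl

theorem irreducible_of_mem_monicFactors {f P : F[X]} (h : P ∈ monicFactors f) :
    Irreducible P := by
  classical
  exact irreducible_of_normalized_factor P h

theorem monic_of_mem_monicFactors {f P : F[X]} (h : P ∈ monicFactors f) : P.Monic := by
  classical
  have hP := irreducible_of_mem_monicFactors h
  rw [← normalize_normalized_factor P h]
  exact monic_normalize hP.ne_zero

theorem dvd_of_mem_monicFactors {f P : F[X]} (h : P ∈ monicFactors f) : P ∣ f := by
  classical
  exact dvd_of_mem_normalizedFactors h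

theorem prod_monicFactors {f : F[X]} (hf : f.Monic) : (monicFactors f).prod = f := by
  classical
  exact (prod_normalizedFactors_eq hf.ne_zero).trans hf.normalize_eq_self

theorem monicFactors_one : monicFactors (1 : F[X]) = 0 := by
  classical
  exact normalizedFactors_one

theorem monicFactors_mul {f g : F[X]} (hf : f ≠ 0) (hg : g ≠ 0) :
    monicFactors (f * g) = monicFactors f + monicFactors g := by
  classical
  exact normalizedFactors_mul hf hg

theorem monicFactors_irreducible {P : F[X]} (hP : Irreducible P) (hm : P.Monic) :
    monicFactors P = {P} := by
  classical
  exact (normalizedFactors_irreducible hP).trans (by rw [hm.normalize_eq_self])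

theorem nodup_monicFactors {f : F[X]} (hf : Squarefree f) : (monicFactors f).Nodup := by
  classical
  exact (squarefree_iff_nodup_normalizedFactors hf.ne_zero).mp hf

/-- Induction on the number of monic irreducible factors of a monic polynomial. -/
theorem monic_induction {p : F[X] → Prop} {f : F[X]} (hf : f.Monic) (one : p 1)
    (mul : ∀ P g : F[X], P.Monic → Irreducible P → g.Monic → p g → p (P * g)) : p f := by
  rw [← prod_monicFactors hf]
  have hs : ∀ P ∈ monicFactors f, P.Monic ∧ Irreducible P := fun P hP =>
    ⟨monic_of_mem_monicFactors hP, irreducible_of_mem_monicFactors hP⟩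
  revert hs
  induction monicFactors f using Multiset.induction_on with
  | empty => intro _; simpa using one
  | cons P s ih =>
    intro hs
    rw [Multiset.prod_cons]
    have hs' : ∀ Q ∈ s, Q.Monic ∧ Irreducible Q :=
      fun Q hQ => hs Q (Multiset.mem_cons_of_mem hQ)
    refine mul P _ (hs P (Multiset.mem_cons_self P s)).1 (hs P (Multiset.mem_cons_self P s)).2
      (Multiset.map_id s ▸ monic_multiset_prod_of_monic s id fun Q hQ => (hs' Q hQ).1) (ih hs')

@[simp] theorem chi_one (D : F[X]) : chi D 1 = 1 := by simp [chi_def, monicFactors_one]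

theorem chi_mul (D : F[X]) {f g : F[X]} (hf : f ≠ 0) (hg : g ≠ 0) :
    chi D (f * g) = chi D f * chi D g := by
  simp [chi_def, monicFactors_mul hf hg]

theorem chi_irreducible (D : F[X]) {P : F[X]} (hP : Irreducible P) (hm : P.Monic) :
    chi D P = residueSymbol D P := by
  simp [chi_def, monicFactors_irreducible hP hm]

theorem abs_chi_le (D f : F[X]) : |chi D f| ≤ 1 := by
  rw [chi_def]
  induction monicFactors f using Multiset.induction_on with
  | empty => simp
  | cons P s ih =>
    rw [Multiset.map_cons, Multiset.prod_cons, abs_mul]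
    refine mul_le_one₀ ?_ (abs_nonneg _) ih
    unfold residueSymbol
    split_ifs <;> simp

variable [Finite F]

theorem chi_mul_left (f g D : F[X]) : chi (f * g) D = chi f D * chi g D := by
  rw [chi_def, chi_def, chi_def, ← Multiset.prod_map_mul]
  exact congrArg Multiset.prod (Multiset.map_congr rfl fun P hP =>
    residueSymbol_mul (irreducible_of_mem_monicFactors hP) f g)

theorem chi_C (h : Odd (Nat.card F)) (c : F) {D : F[X]} (hD : D.Monic) :
    chi (C c) D = quadChar F c ^ D.natDegree := by
  refine monic_induction (p := fun D => chi (C c) D = quadChar F c ^ D.natDegree)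
      hD ?_ ?_
  · simp
  · intro P g hPm hP hg ih
    rw [chi_mul _ hP.ne_zero hg.ne_zero, chi_irreducible _ hP hPm, residueSymbol_C h hP, ih,
      hPm.natDegree_mul hg, pow_add]

/-- Quadratic reciprocity in `F[X]`. -/
theorem chi_reciprocity (h : Odd (Nat.card F)) {f D : F[X]} (hf : f.Monic) (hD : D.Monic) :
    chi D f = quadChar F (-1) ^ (f.natDegree * D.natDegree) * chi f D := by
  have hirr {P : F[X]} (hPm : P.Monic) (hP : Irreducible P) :
      residueSymbol D P = quadChar F (-1) ^ (P.natDegree * D.natDegree) * chi P D := by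
    refine monic_induction (p := fun D =>
      residueSymbol D P = quadChar F (-1) ^ (P.natDegree * D.natDegree) * chi P D)
      hD ?_ ?_
    · rw [← C_1, residueSymbol_C h hP]
      simp
    · intro Q g hQm hQ hg ih
      rw [residueSymbol_mul hP, ih, chi_mul _ hQ.ne_zero hg.ne_zero, chi_irreducible _ hQ hQm,
        residueSymbol_reciprocity h hP hPm hQ hQm, hQm.natDegree_mul hg]
      ring
  refine monic_induction (p := fun f =>
    chi D f = quadChar F (-1) ^ (f.natDegree * D.natDegree) * chi f D)
      hf ?_ ?_
  · rw [← C_1, chi_C h 1 hD]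
    simp
  · intro P g hPm hP hg ih
    rw [chi_mul _ hP.ne_zero hg.ne_zero, chi_mul_left, ih, chi_irreducible _ hP hPm,
      hirr hPm hP, hPm.natDegree_mul hg]
    ring

end jacobi

/-! ### Gauss sums modulo a square-free polynomial -/

section gauss

variable {F : Type*} [Field F]

open scoped Classical in
/-- The monic irreducible factors of `D`. -/
noncomputable def primeFactors (D : F[X]) : Finset F[X] := (monicFactors D).toFinset

theorem mem_primeFactors {D P : F[X]} : P ∈ primeFactors D ↔ P ∈ monicFactors D := by
  simp [primeFactors]

instance (D : F[X]) (P : primeFactors D) : Fact (Irreducible P.1) :=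
  ⟨irreducible_of_mem_monicFactors (mem_primeFactors.mp P.2)⟩

instance [Finite F] (D : F[X]) (P : primeFactors D) : Finite (AdjoinRoot P.1) :=
  finite_adjoinRoot (Fact.out : Irreducible P.1).ne_zero

/-- Reduction of a polynomial modulo all the prime factors of `D`. -/
noncomputable def reduction (D : F[X]) : F[X] →+* ∀ P : primeFactors D, AdjoinRoot P.1 :=
  RingHom.pi fun P => AdjoinRoot.mk P.1

theorem reduction_apply (D f : F[X]) (P : primeFactors D) :
    reduction D f P = AdjoinRoot.mk P.1 f := rfl

theorem chi_eq_piChar {D : F[X]} (hs : Squarefree D) (f : F[X]) :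
    chi f D = piChar (reduction D f) := by
  classical
  have hnd : (monicFactors D).Nodup :=
    nodup_monicFactors hs
  simp_rw [piChar, reduction_apply, ← residueSymbol_eq]
  rw [chi_def, Finset.prod_coe_sort (primeFactors D) fun P => residueSymbol f P,
    Finset.prod_eq_multiset_prod, primeFactors, Multiset.toFinset_val, hnd.dedup]

theorem primeFactors_pairwise_isCoprime (D : F[X]) :
    Pairwise (Function.onFun IsCoprime fun P : primeFactors D => P.1) := by
  intro P Q hPQ
  have hP := mem_primeFactors.mp P.2
  have hQ := mem_primeFactors.mp Q.2
  refine (irreducible_of_mem_monicFactors hP).coprime_iff_not_dvd.mpr fun h => hPQ ?_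
  have := (irreducible_of_mem_monicFactors hP).associated_of_dvd
    (irreducible_of_mem_monicFactors hQ) h
  exact Subtype.ext (eq_of_monic_of_associated (monic_of_mem_monicFactors hP)
    (monic_of_mem_monicFactors hQ) this)

theorem reduction_surjective (D : F[X]) : Function.Surjective (reduction D) := by
  intro s
  choose g hg using fun P => AdjoinRoot.mk_surjective (s P)
  obtain ⟨r, hr⟩ := Ideal.exists_forall_sub_mem_ideal
    (I := fun P : primeFactors D => Ideal.span {P.1})
    (fun P Q hPQ => (Ideal.isCoprime_span_singleton_iff _ _).mpr
      (primeFactors_pairwise_isCoprime D hPQ)) g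
  refine ⟨r, funext fun P => ?_⟩
  rw [reduction_apply, ← hg P, AdjoinRoot.mk_eq_mk, ← Ideal.mem_span_singleton]
  exact hr P

theorem reduction_eq_zero_iff {D : F[X]} (hm : D.Monic) (hs : Squarefree D) (f : F[X]) :
    reduction D f = 0 ↔ D ∣ f := by
  classical
  have hnd : (monicFactors D).Nodup :=
    nodup_monicFactors hs
  have hprod : ∏ P : primeFactors D, P.1 = D := by
    rw [Finset.prod_coe_sort (primeFactors D) fun P => P, Finset.prod_eq_multiset_prod,
      primeFactors, Multiset.toFinset_val, hnd.dedup, Multiset.map_id',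
      prod_monicFactors hm]
  rw [funext_iff]
  simp_rw [reduction_apply, Pi.zero_apply, AdjoinRoot.mk_eq_zero]
  constructor
  · intro h
    rw [← hprod]
    exact Fintype.prod_dvd_of_coprime (primeFactors_pairwise_isCoprime D) h
  · intro h P
    exact (dvd_of_mem_monicFactors (mem_primeFactors.mp P.2)).trans h

theorem sum_polysLT_reduction [Finite F] {D : F[X]} (hm : D.Monic) (hs : Squarefree D)
    [Fintype (∀ P : primeFactors D, AdjoinRoot P.1)]
    (H : (∀ P : primeFactors D, AdjoinRoot P.1) → ℂ) :
    ∑ a ∈ polysLT F D.natDegree, H (reduction D a) = ∑ s, H s := by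
  have hdeg : ((D.natDegree : ℕ) : WithBot ℕ) = D.degree :=
    (degree_eq_natDegree hm.ne_zero).symm
  refine Finset.sum_bij (fun a _ => reduction D a) (fun _ _ => Finset.mem_univ _) ?_ ?_
    (fun _ _ => rfl)
  · intro a ha b hb hab
    rw [mem_polysLT, hdeg] at ha hb
    rw [← sub_eq_zero, ← map_sub, reduction_eq_zero_iff hm hs] at hab
    exact sub_eq_zero.mp (eq_zero_of_dvd_of_degree_lt hab
      ((degree_sub_le _ _).trans_lt (max_lt ha hb)))
  · intro s _
    obtain ⟨f, rfl⟩ := reduction_surjective D s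
    refine ⟨f %ₘ D, ?_, ?_⟩
    · rw [mem_polysLT, hdeg]
      exact degree_modByMonic_lt f hm
    · rw [← sub_eq_zero, ← map_sub, reduction_eq_zero_iff hm hs,
        modByMonic_eq_sub_mul_div]
      simp

/-- An additive character of `F[X]` that is trivial on the multiples of `D` descends to the
product of the residue fields of the prime factors of `D`. -/
theorem exists_addChar_reduction {D : F[X]} (hm : D.Monic) (hs : Squarefree D)
    {θ : AddChar F[X] ℂ} (hθ : ∀ f, θ (D * f) = 1) :
    ∃ Ψ : AddChar (∀ P : primeFactors D, AdjoinRoot P.1) ℂ, ∀ f, Ψ (reduction D f) = θ f := by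
  have hwd (f g : F[X]) (h : reduction D f = reduction D g) : θ f = θ g := by
    rw [← sub_eq_zero, ← map_sub, reduction_eq_zero_iff hm hs] at h
    obtain ⟨k, hk⟩ := h
    rw [sub_eq_iff_eq_add.mp hk, AddChar.map_add_eq_mul, hθ, one_mul]
  let σ := Function.surjInv (reduction_surjective D)
  have hσ (s) : reduction D (σ s) = s := Function.surjInv_eq (reduction_surjective D) s
  refine ⟨⟨fun s => θ (σ s), ?_, fun s t => ?_⟩, fun f => hwd _ _ (hσ _)⟩
  · rw [hwd (σ 0) 0 (by rw [hσ, map_zero]), AddChar.map_zero_eq_one]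
  · rw [hwd (σ (s + t)) (σ s + σ t) (by rw [hσ, map_add, hσ, hσ]), AddChar.map_add_eq_mul]

variable [Finite F]

theorem odd_natCard_residueField (h : Odd (Nat.card F)) (D : F[X]) (P : primeFactors D) :
    Odd (Nat.card (AdjoinRoot P.1)) := by
  rw [natCard_adjoinRoot (Fact.out : Irreducible P.1).ne_zero]
  exact h.pow

theorem sum_chi_mul_shift (h : Odd (Nat.card F)) {D : F[X]} (hm : D.Monic) (hs : Squarefree D)
    {θ : AddChar F[X] ℂ} (hθ : ∀ f, θ (D * f) = 1) (b : F[X]) :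
    ∑ a ∈ polysLT F D.natDegree, (chi a D : ℂ) * θ (a * b) =
      chi b D * ∑ a ∈ polysLT F D.natDegree, (chi a D : ℂ) * θ a := by
  have := Fintype.ofFinite (∀ P : primeFactors D, AdjoinRoot P.1)
  obtain ⟨Ψ, hΨ⟩ := exists_addChar_reduction hm hs hθ
  simp_rw [← hΨ, chi_eq_piChar hs, map_mul]
  rw [sum_polysLT_reduction hm hs fun s => (piChar s : ℂ) * Ψ (s * reduction D b),
    sum_polysLT_reduction hm hs fun s => (piChar s : ℂ) * Ψ s,
    sum_piChar_mul_shift (odd_natCard_residueField h D)]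

theorem sum_chi_mul_addChar (h : Odd (Nat.card F)) {D : F[X]} (hm : D.Monic)
    (hs : Squarefree D) {θ : AddChar F[X] ℂ} (hθ : ∀ f, θ (D * f) = 1)
    (hnd : ∀ f, ¬ D ∣ f → ∃ y, θ (f * y) ≠ 1) :
    ∑ a ∈ polysLT F D.natDegree, (chi a D : ℂ) * θ a =
      ∑ a ∈ polysLT F D.natDegree, θ (a ^ 2) := by
  classical
  have := Fintype.ofFinite (∀ P : primeFactors D, AdjoinRoot P.1)
  obtain ⟨Ψ, hΨ⟩ := exists_addChar_reduction hm hs hθ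
  simp_rw [← hΨ, chi_eq_piChar hs, map_pow]
  rw [sum_polysLT_reduction hm hs fun s => (piChar s : ℂ) * Ψ s,
    sum_polysLT_reduction hm hs fun s => Ψ (s ^ 2),
    sum_piChar_mul_addChar (odd_natCard_residueField h D)]
  intro P
  obtain ⟨f, hf⟩ := reduction_surjective D (Pi.single P 1)
  obtain ⟨y, hy⟩ := hnd f fun hdvd => by
    rw [← reduction_eq_zero_iff hm hs, hf] at hdvd
    simpa using congrFun hdvd P
  refine ⟨reduction D (f * y), fun Q hQ => ?_, by rwa [hΨ]⟩
  rw [map_mul, hf, Pi.mul_apply, Pi.single_eq_of_ne hQ, zero_mul]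

end gauss


/-! ### The functional equation -/

section functionalEquation

variable {F : Type*} [Field F]

/-- The coefficient of `X ^ (deg D - 1)` in the remainder of `f` modulo `D`, that is, up to sign
the residue at infinity of `f / D`. -/
noncomputable def topCoeff (D : F[X]) : F[X] →ₗ[F] F :=
  lcoeff F (D.natDegree - 1) ∘ₗ modByMonicHom D

theorem topCoeff_of_degree_lt {D f : F[X]} (hD : D.Monic) (hf : f.degree < D.natDegree) :
    topCoeff D f = f.coeff (D.natDegree - 1) := by
  rw [← degree_eq_natDegree hD.ne_zero] at hf
  simp [topCoeff, modByMonicHom_apply, (modByMonic_eq_self_iff hD).mpr hf]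

theorem topCoeff_self_mul {D : F[X]} (hD : D.Monic) (f : F[X]) : topCoeff D (D * f) = 0 := by
  simp [topCoeff, modByMonicHom_apply, (modByMonic_eq_zero_iff_dvd hD).mpr (dvd_mul_right D f)]

/-- The additive character `f ↦ ψ (res (f / D))` of `F[X]`. -/
noncomputable def modChar (D : F[X]) (ψ : AddChar F ℂ) : AddChar F[X] ℂ :=
  ψ.compAddMonoidHom (topCoeff D).toAddMonoidHom

theorem modChar_apply (D : F[X]) (ψ : AddChar F ℂ) (f : F[X]) :
    modChar D ψ f = ψ (topCoeff D f) := rfl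

theorem modChar_self_mul {D : F[X]} (hD : D.Monic) (ψ : AddChar F ℂ) (f : F[X]) :
    modChar D ψ (D * f) = 1 := by
  rw [modChar_apply, topCoeff_self_mul hD, AddChar.map_zero_eq_one]

/-- The pairing `(a, v) ↦ res (a * v / D)` is nondegenerate: a monomial `v` of complementary
degree detects the leading coefficient of `a`. -/
theorem exists_modChar_mul_ne_one {D : F[X]} (hD : D.Monic) {ψ : AddChar F ℂ} (hψ : ψ ≠ 1)
    {a : F[X]} (ha : a ≠ 0) (hdeg : a.degree < D.natDegree) :
    ∃ v : F[X], v.degree ≤ ((D.natDegree - 1 - a.natDegree : ℕ) : WithBot ℕ) ∧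
      modChar D ψ (a * v) ≠ 1 := by
  obtain ⟨t, ht⟩ := AddChar.ne_one_iff.mp hψ
  have hdeg' : a.natDegree < D.natDegree := (natDegree_lt_iff_degree_lt ha).mpr hdeg
  refine ⟨C (a.leadingCoeff⁻¹ * t) * X ^ (D.natDegree - 1 - a.natDegree),
    degree_C_mul_X_pow_le _ _, ?_⟩
  have hlt : (a * (C (a.leadingCoeff⁻¹ * t) * X ^ (D.natDegree - 1 - a.natDegree))).degree <
      (D.natDegree : WithBot ℕ) := by
    refine (degree_mul_le_of_le (degree_le_natDegree) (degree_C_mul_X_pow_le _ _)).trans_lt ?_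
    exact_mod_cast (by omega : a.natDegree + (D.natDegree - 1 - a.natDegree) < D.natDegree)
  rw [modChar_apply, topCoeff_of_degree_lt hD hlt]
  have hc : (a * (C (a.leadingCoeff⁻¹ * t) * X ^ (D.natDegree - 1 - a.natDegree))).coeff
      (D.natDegree - 1) = t := by
    have h1 : D.natDegree - 1 = a.natDegree + (D.natDegree - 1 - a.natDegree) := by omega
    rw [← mul_assoc]
    conv_lhs => rw [h1]
    rw [show a.natDegree + (D.natDegree - 1 - a.natDegree) - a.natDegree =
      D.natDegree - 1 - a.natDegree by omega, coeff_mul_X_pow, coeff_mul_C, coeff_natDegree,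
      mul_inv_cancel_left₀ (leadingCoeff_ne_zero.mpr ha)]
  rwa [hc]

theorem chi_add_mul {D : F[X]} (f h : F[X]) : chi (f + D * h) D = chi f D := by
  rw [chi_def, chi_def]
  refine congrArg Multiset.prod (Multiset.map_congr rfl fun P hP => ?_)
  have : Fact (Irreducible P) := ⟨irreducible_of_mem_monicFactors hP⟩
  rw [residueSymbol_eq, residueSymbol_eq, map_add,
    AdjoinRoot.mk_eq_zero.mpr ((dvd_of_mem_monicFactors hP).mul_right h), add_zero]

variable [Finite F]

/-- The polynomials of degree less than `k` and those of degree less than `deg D - k` are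
orthogonal complements modulo `D`. -/
theorem sum_modChar_mul {D : F[X]} (hD : D.Monic) {ψ : AddChar F ℂ} (hψ : ψ ≠ 1) {a : F[X]}
    (ha : a.degree < D.natDegree) {k : ℕ} (hk : k ≤ D.natDegree) :
    ∑ v ∈ polysLT F k, modChar D ψ (a * v) =
      if a.degree < ((D.natDegree - k : ℕ) : WithBot ℕ) then (Nat.card F : ℂ) ^ k else 0 := by
  split_ifs with h
  · have h1 : ∀ v ∈ polysLT F k, modChar D ψ (a * v) = 1 := by
      intro v hv
      rw [mem_polysLT] at hv
      rcases eq_or_ne v 0 with rfl | hv0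
      · simp
      rcases eq_or_ne a 0 with rfl | ha0
      · simp
      rw [← natDegree_lt_iff_degree_lt ha0] at h
      rw [← natDegree_lt_iff_degree_lt hv0] at hv
      have hd : (a * v).natDegree < D.natDegree - 1 := by
        rw [natDegree_mul ha0 hv0]; omega
      rw [modChar_apply, topCoeff_of_degree_lt hD, coeff_eq_zero_of_natDegree_lt hd,
        AddChar.map_zero_eq_one]
      rw [← natDegree_lt_iff_degree_lt (mul_ne_zero ha0 hv0)]
      omega
    rw [Finset.sum_congr rfl h1]
    simp [card_polysLT]
  · rcases eq_or_ne a 0 with rfl | ha0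
    · simp at h
    obtain ⟨v, hv, hne⟩ := exists_modChar_mul_ne_one hD hψ ha0 ha
    rw [← natDegree_lt_iff_degree_lt ha0] at h ha
    refine sum_polysLT_addChar_eq_zero
      ((modChar D ψ).compAddMonoidHom (AddMonoidHom.mulLeft a)) (hv.trans_lt ?_) hne
    exact_mod_cast (by omega : D.natDegree - 1 - a.natDegree < k)

theorem filter_polysLT {j n : ℕ} (h : j ≤ n) :
    (polysLT F n).filter (fun f => f.degree < (j : WithBot ℕ)) = polysLT F j := by
  ext f
  simp only [Finset.mem_filter, mem_polysLT, and_iff_right_iff_imp]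
  exact fun hf => hf.trans_le (by exact_mod_cast h)

/-- The quadratic Gauss sum modulo `D` of degree `2 * g + 1`. The polynomials of degree less than
`g` form a totally isotropic subspace for `x ↦ res (x ^ 2 / D)`, with orthogonal complement the
polynomials of degree less than `g + 1`, so only the form `c ↦ c ^ 2` in one variable is left. -/
theorem sum_modChar_sq [Fintype F] (hodd : Odd (Nat.card F)) {D : F[X]} (hD : D.Monic) {g : ℕ}
    (hg : D.natDegree = 2 * g + 1) {ψ : AddChar F ℂ} (hψ : ψ ≠ 1) :
    ∑ x ∈ polysLT F D.natDegree, modChar D ψ (x ^ 2) =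
      (Nat.card F : ℂ) ^ g * ∑ c : F, ψ (c ^ 2) := by
  have hq : (Nat.card F : ℂ) ^ g ≠ 0 := pow_ne_zero _ (by exact_mod_cast Nat.card_pos.ne')
  have h2 : (2 : F) ≠ 0 := by
    have := ringChar_ne_two_of_odd hodd
    exact Ring.two_ne_zero this
  have htop (f : F[X]) (hf : f.degree ≤ ((2 * g : ℕ) : WithBot ℕ)) :
      topCoeff D f = f.coeff (2 * g) := by
    rw [topCoeff_of_degree_lt hD, hg, Nat.add_sub_cancel]
    rw [hg]
    exact hf.trans_lt (by exact_mod_cast Nat.lt_succ_self _)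
  -- the square of a polynomial of degree less than `g + 1`
  have hsq (c : F) (v : F[X]) (hv : v ∈ polysLT F g) :
      modChar D ψ ((C c * X ^ g + v) ^ 2) = ψ (c ^ 2) := by
    rw [mem_polysLT] at hv
    have hle : (C c * X ^ g + v).natDegree ≤ g :=
      natDegree_le_iff_degree_le.mpr (degree_add_le_of_degree_le (degree_C_mul_X_pow_le _ _) hv.le)
    rw [modChar_apply, htop, coeff_pow_of_natDegree_le hle]
    · simp [coeff_eq_zero_of_degree_lt hv]
    · exact natDegree_le_iff_degree_le.mp (natDegree_pow_le_of_le 2 hle)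
  -- average over translations by the isotropic subspace
  have hav : ∑ v ∈ polysLT F g, ∑ x ∈ polysLT F D.natDegree, modChar D ψ ((v + x) ^ 2) =
      (Nat.card F : ℂ) ^ g * ∑ x ∈ polysLT F D.natDegree, modChar D ψ (x ^ 2) := by
    rw [Finset.sum_congr rfl (g := fun _ => ∑ x ∈ polysLT F D.natDegree, modChar D ψ (x ^ 2))]
    · simp [card_polysLT]
    · intro v hv
      refine sum_polysLT_add (h := fun x => modChar D ψ (x ^ 2)) ?_
      exact (mem_polysLT.mp hv).trans_le (by rw [hg]; exact_mod_cast (by omega))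
  have hexp : ∀ v ∈ polysLT F g, ∀ x ∈ polysLT F D.natDegree,
      modChar D ψ ((v + x) ^ 2) = modChar D ψ (x ^ 2) * modChar D ψ (C 2 * x * v) := by
    intro v hv x _
    have h0 : modChar D ψ (v ^ 2) = 1 := by simpa using hsq 0 v hv
    rw [show (v + x) ^ 2 = v ^ 2 + (x ^ 2 + C 2 * x * v) by rw [C_ofNat]; ring,
      AddChar.map_add_eq_mul, AddChar.map_add_eq_mul, h0, one_mul]
  apply mul_left_cancel₀ hq
  rw [← hav, Finset.sum_congr rfl fun v hv => Finset.sum_congr rfl (hexp v hv), Finset.sum_comm]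
  simp_rw [← Finset.mul_sum]
  have horth : ∀ x ∈ polysLT F D.natDegree,
      modChar D ψ (x ^ 2) * ∑ v ∈ polysLT F g, modChar D ψ (C 2 * x * v) =
        if x.degree < ((g + 1 : ℕ) : WithBot ℕ) then
          modChar D ψ (x ^ 2) * (Nat.card F : ℂ) ^ g else 0 := by
    intro x hx
    rw [mem_polysLT] at hx
    have hdeg : (C 2 * x).degree = x.degree := degree_C_mul h2
    rw [sum_modChar_mul hD hψ (by rwa [hdeg]) (by omega), hdeg,
      show D.natDegree - g = g + 1 by omega, mul_ite, mul_zero]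
  rw [Finset.sum_congr rfl horth, ← Finset.sum_filter, filter_polysLT (by omega),
    ← Finset.sum_mul, mul_comm, sum_polysLT_succ,
    Finset.sum_congr rfl fun c _ => Finset.sum_congr rfl (hsq c)]
  simp [card_polysLT, Finset.mul_sum]

theorem chi_C_mul_of_odd (hodd : Odd (Nat.card F)) {D : F[X]} (hD : D.Monic)
    (hdeg : Odd D.natDegree) (c : F) (f : F[X]) :
    chi (C c * f) D = quadChar F c * chi f D := by
  rw [chi_mul_left, chi_C hodd c hD]
  congr 1
  obtain ⟨k, hk⟩ := hdeg
  rw [hk]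
  rcases eq_or_ne c 0 with rfl | hc
  · simp
  · rw [pow_succ, pow_mul, pow_two, quadChar_sq hc, one_pow, one_mul]

/-- Scaling by a nonresidue of `F` changes the sign of the symbol. -/
theorem sum_polysLT_chi (hodd : Odd (Nat.card F)) {D : F[X]} (hD : D.Monic)
    (hdeg : Odd D.natDegree) (n : ℕ) : ∑ v ∈ polysLT F n, chi v D = 0 := by
  obtain ⟨c, hc⟩ := exists_quadChar_eq_neg_one hodd
  have hc0 : c ≠ 0 := by rintro rfl; simp at hc
  have := sum_polysLT_C_mul (n := n) hc0 fun v => chi v D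
  simp_rw [chi_C_mul_of_odd hodd hD hdeg, hc, ← Finset.mul_sum] at this
  omega

theorem sum_monicOfDegree_chi_eq_zero (hodd : Odd (Nat.card F)) {D : F[X]} (hD : D.Monic)
    (hdeg : Odd D.natDegree) {n : ℕ} (hn : D.natDegree ≤ n) :
    ∑ f ∈ monicOfDegree F n, chi f D = 0 := by
  -- translating by the remainder of `X ^ n` turns the monic polynomials into a subspace modulo `D`
  have hr : (-(X ^ n %ₘ D)).degree < n := by
    rw [degree_neg]
    refine (degree_modByMonic_lt _ hD).trans_le ?_
    rw [degree_eq_natDegree hD.ne_zero]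
    exact_mod_cast hn
  rw [sum_monicOfDegree, ← sum_polysLT_add hr, ← sum_polysLT_chi hodd hD hdeg n]
  refine Finset.sum_congr rfl fun v _ => ?_
  rw [← chi_add_mul v (X ^ n /ₘ D)]
  congr 1
  linear_combination -(modByMonic_add_div (X ^ n) D)

theorem sum_quadChar_mul_addChar_ne_zero [Fintype F] (hodd : Odd (Nat.card F))
    {ψ : AddChar F ℂ} (hψ : ψ ≠ 1) : ∑ c : F, (quadChar F c : ℂ) * ψ c ≠ 0 := by
  classical
  have h := gaussSum_ne_zero_of_nontrivial (χ := (quadraticChar F).ringHomComp (Int.castRingHom ℂ))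
    (ψ := ψ) (by exact_mod_cast Fintype.card_ne_zero)
    ((MulChar.ringHomComp_ne_one_iff (RingHom.injective_int _)).mpr
      (quadraticChar_ne_one (ringChar_ne_two_of_odd hodd)))
    (AddChar.IsPrimitive.of_ne_one hψ)
  simpa [gaussSum, quadChar_eq] using h

/-- Poisson summation over the monic polynomials of degree `k`: `G` and `τ` are the Gauss sums
modulo `D` and over `F`. -/
theorem gaussSum_mul_sum_monicOfDegree [Fintype F] (hodd : Odd (Nat.card F)) {D : F[X]}
    (hD : D.Monic) (hs : Squarefree D) {g : ℕ} (hg : D.natDegree = 2 * g + 1)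
    {ψ : AddChar F ℂ} (hψ : ψ ≠ 1) {k : ℕ} (hk : k ≤ 2 * g) :
    (∑ a ∈ polysLT F D.natDegree, (chi a D : ℂ) * modChar D ψ a) *
        ∑ f ∈ monicOfDegree F k, (chi f D : ℂ) =
      (Nat.card F : ℂ) ^ k * (∑ c : F, (quadChar F c : ℂ) * ψ c) *
        ∑ f ∈ monicOfDegree F (2 * g - k), (chi f D : ℂ) := by
  have hdegD : Odd D.natDegree := ⟨g, hg⟩
  have hshift (b : F[X]) := sum_chi_mul_shift hodd hD hs (modChar_self_mul hD ψ) b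
  obtain ⟨j, hj⟩ : ∃ j, 2 * g = k + j := ⟨2 * g - k, by omega⟩
  have hj' : 2 * g - k = j := by omega
  rw [mul_comm, Finset.sum_mul]
  simp_rw [← hshift]
  rw [sum_monicOfDegree k fun f => ∑ a ∈ polysLT F D.natDegree, (chi a D : ℂ) * modChar D ψ (a * f),
    Finset.sum_comm]
  have horth : ∀ a ∈ polysLT F D.natDegree,
      ∑ v ∈ polysLT F k, (chi a D : ℂ) * modChar D ψ (a * (X ^ k + v)) =
        if a.degree < ((j + 1 : ℕ) : WithBot ℕ) then
          (Nat.card F : ℂ) ^ k * ((chi a D : ℂ) * modChar D ψ (a * X ^ k)) else 0 := by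
    intro a ha
    rw [mem_polysLT] at ha
    simp_rw [mul_add, AddChar.map_add_eq_mul, ← mul_assoc, ← Finset.mul_sum]
    rw [sum_modChar_mul hD hψ ha (by omega), show D.natDegree - k = j + 1 by omega, mul_ite,
      mul_zero]
    congr 1
    ring
  have htop : ∀ c : F, ∀ v ∈ polysLT F j,
      modChar D ψ ((C c * X ^ j + v) * X ^ k) = ψ c := by
    intro c v hv
    rw [mem_polysLT] at hv
    have hlt : ((C c * X ^ j + v) * X ^ k).degree < (D.natDegree : WithBot ℕ) := by
      refine (degree_mul_le_of_le (degree_add_le_of_degree_le (degree_C_mul_X_pow_le _ _) hv.le)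
        (degree_X_pow_le k)).trans_lt ?_
      exact_mod_cast (by omega : j + k < D.natDegree)
    rw [modChar_apply, topCoeff_of_degree_lt hD hlt, show D.natDegree - 1 = j + k by omega,
      coeff_mul_X_pow]
    simp [coeff_eq_zero_of_degree_lt hv]
  -- leading coefficient `0` contributes nothing; the others scale the sum over monic polynomials
  have hfib (c : F) : ∑ v ∈ polysLT F j, (chi (C c * X ^ j + v) D : ℂ) =
      quadChar F c * ∑ f ∈ monicOfDegree F j, (chi f D : ℂ) := by
    rcases eq_or_ne c 0 with rfl | hc
    · simpa using (by exact_mod_cast sum_polysLT_chi hodd hD hdegD j :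
        ∑ v ∈ polysLT F j, (chi v D : ℂ) = 0)
    · rw [sum_monicOfDegree, ← sum_polysLT_C_mul hc, Finset.mul_sum]
      refine Finset.sum_congr rfl fun v _ => ?_
      rw [← mul_add, chi_C_mul_of_odd hodd hD hdegD, Int.cast_mul]
  rw [Finset.sum_congr rfl horth, ← Finset.sum_filter, filter_polysLT (by omega),
    ← Finset.mul_sum, sum_polysLT_succ, mul_assoc, hj']
  congr 1
  rw [Finset.sum_mul]
  refine Finset.sum_congr rfl fun c _ => ?_
  rw [Finset.sum_congr rfl fun v hv => by rw [htop c v hv], ← Finset.sum_mul, hfib]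
  ring

/-- The functional equation for the sums of `f ↦ (f / D)`. -/
theorem sum_monicOfDegree_chi_symm (hodd : Odd (Nat.card F)) {D : F[X]}
    (hD : D.Monic) (hs : Squarefree D) {g : ℕ} (hg : D.natDegree = 2 * g + 1) {k : ℕ}
    (hk : k ≤ 2 * g) :
    (Nat.card F : ℂ) ^ g * ∑ f ∈ monicOfDegree F k, (chi f D : ℂ) =
      (Nat.card F : ℂ) ^ k * ∑ f ∈ monicOfDegree F (2 * g - k), (chi f D : ℂ) := by
  have := Fintype.ofFinite F
  obtain ⟨ψ, hψ1⟩ := AddChar.exists_apply_ne_zero.mpr (one_ne_zero (α := F))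
  have hψ : ψ ≠ 1 := by rintro rfl; simp at hψ1
  have hG : ∑ a ∈ polysLT F D.natDegree, (chi a D : ℂ) * modChar D ψ a =
      (Nat.card F : ℂ) ^ g * ∑ c : F, (quadChar F c : ℂ) * ψ c := by
    rw [sum_quadChar_mul_addChar hodd hψ, ← sum_modChar_sq hodd hD hg hψ]
    refine sum_chi_mul_addChar hodd hD hs (modChar_self_mul hD ψ) fun f hf => ?_
    have hr : f %ₘ D ≠ 0 := fun h => hf ((modByMonic_eq_zero_iff_dvd hD).mp h)
    obtain ⟨v, -, hv⟩ := exists_modChar_mul_ne_one hD hψ hr (by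
      rw [← degree_eq_natDegree hD.ne_zero]
      exact degree_modByMonic_lt f hD)
    refine ⟨v, ?_⟩
    rwa [← modByMonic_add_div f D, add_mul, AddChar.map_add_eq_mul, mul_assoc,
      modChar_self_mul hD, mul_one]
  have h := gaussSum_mul_sum_monicOfDegree hodd hD hs hg hψ hk
  rw [hG] at h
  apply mul_left_cancel₀ (sum_quadChar_mul_addChar_ne_zero hodd hψ)
  linear_combination h

/-- The sum of `χ_D` over the monic polynomials of degree `n`, the `n`-th coefficient of the
`L`-function. -/
noncomputable def charSum (D : F[X]) (n : ℕ) : ℤ := ∑ f ∈ monicOfDegree F n, chi D f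

theorem charSum_eq (hodd : Odd (Nat.card F)) {D : F[X]} (hD : D.Monic) (n : ℕ) :
    charSum D n = quadChar F (-1) ^ (n * D.natDegree) * ∑ f ∈ monicOfDegree F n, chi f D := by
  rw [charSum, Finset.mul_sum]
  refine Finset.sum_congr rfl fun f hf => ?_
  rw [mem_monicOfDegree] at hf
  rw [chi_reciprocity hodd hf.1 hD, hf.2]

theorem charSum_eq_zero (hodd : Odd (Nat.card F)) {D : F[X]} (hD : D.Monic)
    (hdeg : Odd D.natDegree) {n : ℕ} (hn : D.natDegree ≤ n) : charSum D n = 0 := by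
  rw [charSum_eq hodd hD, sum_monicOfDegree_chi_eq_zero hodd hD hdeg hn, mul_zero]

/-- The functional equation of the `L`-function of `χ_D`, in terms of its coefficients. -/
theorem charSum_symm (hodd : Odd (Nat.card F)) {D : F[X]} (hD : D.Monic) (hs : Squarefree D)
    {g : ℕ} (hg : D.natDegree = 2 * g + 1) {k : ℕ} (hk : k ≤ 2 * g) :
    (Nat.card F : ℤ) ^ g * charSum D k = (Nat.card F : ℤ) ^ k * charSum D (2 * g - k) := by
  have hsign : quadChar F (-1) ^ (k * D.natDegree) =
      quadChar F (-1) ^ ((2 * g - k) * D.natDegree) := by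
    have h1 := quadChar_neg_one_sq (K := F)
    obtain ⟨j, rfl⟩ : ∃ j, k = 2 * g - j := ⟨2 * g - k, by omega⟩
    have key (a b : ℕ) (h : (a + b) % 2 = 0) : quadChar F (-1) ^ a = quadChar F (-1) ^ b := by
      rw [← Nat.div_add_mod a 2, ← Nat.div_add_mod b 2, pow_add, pow_add, pow_mul, pow_mul, h1,
        one_pow, one_pow, show a % 2 = b % 2 by omega]
    apply key
    rw [← add_mul, show 2 * g - j + (2 * g - (2 * g - j)) = 2 * g by omega, mul_assoc,
      Nat.mul_mod_right]
  have h := sum_monicOfDegree_chi_symm hodd hD hs hg hk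
  have h' : (Nat.card F : ℤ) ^ g * ∑ f ∈ monicOfDegree F k, chi f D =
      (Nat.card F : ℤ) ^ k * ∑ f ∈ monicOfDegree F (2 * g - k), chi f D := by
    exact_mod_cast h
  rw [charSum_eq hodd hD, charSum_eq hodd hD, ← hsign]
  linear_combination quadChar F (-1) ^ (k * D.natDegree) * h'

end functionalEquation


/-! ### Counting points on the curve -/

section pointCount

variable {F : Type*} [Field F] {K : Type*} [Field K] [Algebra F K]

theorem homogEval_one {g : ℕ} {D : F[X]} (hD : D.natDegree = 2 * g + 1) (x : K) :
    homogEval g D K x 1 = aeval x D := by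
  rw [aeval_eq_sum_range' (n := 2 * g + 3) (by omega)]
  simp [homogEval, Algebra.smul_def]

theorem homogEval_mul (g : ℕ) (D : F[X]) (t x z : K) :
    homogEval g D K (t * x) (t * z) = t ^ (2 * g + 2) * homogEval g D K x z := by
  rw [homogEval, homogEval, Finset.mul_sum]
  refine Finset.sum_congr rfl fun i hi => ?_
  have : 2 * g + 2 = i + (2 * g + 2 - i) := by
    have := Finset.mem_range.mp hi
    omega
  rw [mul_pow, mul_pow]
  conv_rhs => rw [this, pow_add]
  rw [Nat.add_sub_cancel_left]
  ring

theorem homogEval_zero_right {g : ℕ} {D : F[X]} (hD : D.natDegree = 2 * g + 1) (x : K) :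
    homogEval g D K x 0 = 0 := by
  refine Finset.sum_eq_zero fun i hi => ?_
  have hi := Finset.mem_range.mp hi
  rcases eq_or_ne i (2 * g + 2) with rfl | h
  · rw [coeff_eq_zero_of_natDegree_lt (by omega)]
    simp
  · rw [zero_pow (by omega), mul_zero]

/-- The affine points of `y ^ 2 = D(x)` together with a symbol for the point at infinity,
mapped to the curve. -/
noncomputable def affineToCurve {g : ℕ} {D : F[X]} (hD : D.natDegree = 2 * g + 1) :
    Option {p : K × K // p.2 ^ 2 = aeval p.1 D} → CurvePoint g D K
  | none => Quotient.mk (curveSetoid g D K)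
      ⟨(1, 0, 0), by simp, by simp [homogEval_zero_right hD]⟩
  | some p => Quotient.mk (curveSetoid g D K)
      ⟨(p.1.1, p.1.2, 1), by simp, by simpa [homogEval_one hD] using p.2⟩

theorem affineToCurve_bijective {g : ℕ} {D : F[X]} (hD : D.natDegree = 2 * g + 1) :
    Function.Bijective (affineToCurve (K := K) hD) := by
  constructor
  · rintro (_ | ⟨⟨x, y⟩, hp⟩) (_ | ⟨⟨x', y'⟩, hp'⟩) h
    · rfl
    · obtain ⟨t, ht, h⟩ := Quotient.exact h
      simp at h
    · obtain ⟨t, ht, h⟩ := Quotient.exact h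
      simp [ht.symm] at h
    · obtain ⟨t, ht, h⟩ := Quotient.exact h
      simp only [Prod.mk.injEq, mul_one] at h
      obtain ⟨h1, h2, rfl⟩ := h
      simp only [one_mul, one_pow] at h1 h2
      subst h1 h2
      rfl
  · intro P
    induction P using Quotient.inductionOn with
    | h v =>
      obtain ⟨⟨x, y, z⟩, hne, hv⟩ := v
      by_cases hz : z = 0
      · subst hz
        simp only [homogEval_zero_right hD] at hv
        have hy : y = 0 := by simpa using hv
        subst hy
        have hx : x ≠ 0 := by
          rintro rfl
          exact hne rfl
        exact ⟨none, Quotient.sound ⟨x, hx, by simp⟩⟩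
      · have hpt : (z⁻¹ ^ (g + 1) * y) ^ 2 = aeval (z⁻¹ * x) D := by
          rw [← homogEval_one hD, ← inv_mul_cancel₀ hz, homogEval_mul, ← hv]
          simp only []
          ring
        refine ⟨some ⟨(z⁻¹ * x, z⁻¹ ^ (g + 1) * y), hpt⟩, Quotient.sound ⟨z, hz, ?_⟩⟩
        simp [hz]

theorem natCard_curvePoint [Fintype K] (hodd : Odd (Nat.card K)) {g : ℕ} {D : F[X]}
    (hD : D.natDegree = 2 * g + 1) :
    (Nat.card (CurvePoint g D K) : ℤ) =
      Nat.card K + 1 + ∑ x : K, quadChar K (aeval x D) := by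
  rw [← Nat.card_congr (Equiv.ofBijective _ (affineToCurve_bijective (K := K) hD)),
    Finite.card_option,
    Nat.card_congr (Equiv.subtypeProdEquivSigmaSubtype fun x y : K => y ^ 2 = aeval x D),
    Nat.card_sigma]
  push_cast
  simp_rw [natCard_sqrt hodd, Finset.sum_add_distrib]
  simp
  ring

/-- If `P` is the minimal polynomial of `x`, then `D(x)` lies in the subfield `F[X] / (P)`, and
the quadratic character of `K` restricts to a power of that of the subfield. -/
theorem quadChar_aeval [Finite K] [Finite F] (hodd : Odd (Nat.card F)) (D : F[X]) (x : K) :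
    quadChar K (aeval x D) =
      residueSymbol D (minpoly F x) ^ (Module.finrank F K / (minpoly F x).natDegree) := by
  have : Module.Finite F K := Module.Finite.of_finite
  have hint := Algebra.IsIntegral.isIntegral (R := F) x
  have hirr := minpoly.irreducible hint
  have : Fact (Irreducible (minpoly F x)) := ⟨hirr⟩
  have := finite_adjoinRoot hirr.ne_zero
  let φ : AdjoinRoot (minpoly F x) →ₐ[F] K :=
    AdjoinRoot.liftAlgHom _ (Algebra.ofId F K) x (minpoly.aeval F x)
  let : Algebra (AdjoinRoot (minpoly F x)) K := φ.toRingHom.toAlgebra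
  have : IsScalarTower F (AdjoinRoot (minpoly F x)) K := IsScalarTower.of_algHom φ
  have hφ : aeval x D = algebraMap (AdjoinRoot (minpoly F x)) K (AdjoinRoot.mk _ D) :=
    (AdjoinRoot.liftAlgHom_mk _ (Algebra.ofId F K) x (minpoly.aeval F x) D).symm
  have hfin := Module.finrank_mul_finrank F (AdjoinRoot (minpoly F x)) K
  rw [finrank_adjoinRoot hirr.ne_zero] at hfin
  have hodd' : Odd (Nat.card (AdjoinRoot (minpoly F x))) := by
    rw [natCard_adjoinRoot hirr.ne_zero]
    exact hodd.pow
  rw [hφ, quadChar_algebraMap hodd', residueSymbol_eq, ← hfin,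
    Nat.mul_div_cancel_left _ hirr.natDegree_pos]

theorem splits_of_natDegree_dvd [Finite K] [Finite F] {P : F[X]} (hP : Irreducible P)
    (hm : P.Monic) (h : P.natDegree ∣ Module.finrank F K) : (P.map (algebraMap F K)).Splits := by
  have : Fact (Irreducible P) := ⟨hP⟩
  have := finite_adjoinRoot hP.ne_zero
  have : Module.Finite F K := Module.Finite.of_finite
  obtain ⟨φ⟩ := FiniteField.nonempty_algHom_of_finrank_dvd (F := F) (K := AdjoinRoot P) (L := K)
    (by rwa [finrank_adjoinRoot hP.ne_zero])
  have hroot : aeval (φ (AdjoinRoot.root P)) P = 0 := by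
    rw [aeval_algHom_apply, AdjoinRoot.aeval_eq, AdjoinRoot.mk_self, map_zero]
  rw [minpoly.eq_of_irreducible_of_monic hP hroot hm]
  exact Normal.splits inferInstance _

/-- A monic irreducible `P` whose degree divides `[K : F]` is the minimal polynomial of
exactly `deg P` elements of `K`. -/
theorem card_filter_minpoly [Fintype K] [Finite F] {P : F[X]} (hP : Irreducible P)
    (hm : P.Monic) (h : P.natDegree ∣ Module.finrank F K) [DecidableEq F[X]] :
    (Finset.univ.filter fun x : K => minpoly F x = P).card = P.natDegree := by
  classical
  have hnd : (P.aroots K).Nodup := nodup_roots (PerfectField.separable_of_irreducible hP).map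
  have : (Finset.univ.filter fun x : K => minpoly F x = P) = (P.aroots K).toFinset := by
    ext x
    simp only [Finset.mem_filter, Finset.mem_univ, true_and, Multiset.mem_toFinset,
      mem_aroots, ne_eq, hP.ne_zero, not_false_eq_true]
    constructor
    · rintro rfl
      exact minpoly.aeval F x
    · intro hx
      exact (minpoly.eq_of_irreducible_of_monic hP hx hm).symm
  rw [this, Multiset.toFinset_card_of_nodup hnd,
    ← (splits_of_natDegree_dvd hP hm h).natDegree_eq_card_roots, natDegree_map]

open scoped Classical in
/-- The monic irreducible polynomials whose degree divides `n`. -/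
noncomputable def primesDvd (F : Type*) [Field F] [Finite F] (n : ℕ) : Finset F[X] :=
  (n.divisors.biUnion fun d => monicOfDegree F d).filter Irreducible

theorem mem_primesDvd [Finite F] {n : ℕ} (hn : n ≠ 0) {P : F[X]} :
    P ∈ primesDvd F n ↔ P.Monic ∧ Irreducible P ∧ P.natDegree ∣ n := by
  simp [primesDvd, hn]
  tauto

theorem sum_quadChar_aeval [Fintype K] [Finite F] (hodd : Odd (Nat.card F)) (D : F[X]) :
    ∑ x : K, quadChar K (aeval x D) =
      ∑ P ∈ primesDvd F (Module.finrank F K),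
        P.natDegree * chi D P ^ (Module.finrank F K / P.natDegree) := by
  classical
  have : Module.Finite F K := Module.Finite.of_finite
  have hn : Module.finrank F K ≠ 0 := Module.finrank_pos.ne'
  have hmaps : ∀ x ∈ (Finset.univ : Finset K), minpoly F x ∈ primesDvd F (Module.finrank F K) := by
    intro x _
    have hint := Algebra.IsIntegral.isIntegral (R := F) x
    exact (mem_primesDvd hn).mpr
      ⟨minpoly.monic hint, minpoly.irreducible hint, minpoly.degree_dvd hint⟩
  rw [← Finset.sum_fiberwise_of_maps_to hmaps]
  refine Finset.sum_congr rfl fun P hP => ?_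
  obtain ⟨hm, hirr, hdvd⟩ := (mem_primesDvd hn).mp hP
  rw [Finset.sum_congr rfl (g := fun _ => chi D P ^ (Module.finrank F K / P.natDegree)),
    Finset.sum_const, card_filter_minpoly hirr hm hdvd, nsmul_eq_mul]
  intro x hx
  rw [quadChar_aeval hodd, (Finset.mem_filter.mp hx).2, chi_irreducible D hirr hm]

theorem pointCount_eq [Finite F] (hodd : Odd (Nat.card F)) {g : ℕ} {D : F[X]}
    (hD : D.natDegree = 2 * g + 1) (n : ℕ) [NeZero n] :
    (pointCount g D n : ℤ) = Nat.card F ^ n + 1 +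
      ∑ P ∈ primesDvd F n, P.natDegree * chi D P ^ (n / P.natDegree) := by
  have : Fact (ringChar F).Prime := ⟨CharP.char_is_prime F (ringChar F)⟩
  have := Fintype.ofFinite (FiniteField.Extension F (ringChar F) n)
  have hcard := FiniteField.natCard_extension F (ringChar F) n
  rw [pointCount, natCard_curvePoint (by rw [hcard]; exact hodd.pow) hD,
    sum_quadChar_aeval hodd, hcard, FiniteField.finrank_extension]
  push_cast
  rfl

end pointCount


/-! ### Euler products over the monic irreducible polynomials -/

section eulerProduct

open Filter Topology

variable {F : Type*} [Field F]

theorem mem_monicFactors_iff {f P : F[X]} (hf : f.Monic) (hP : Irreducible P) (hm : P.Monic) :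
    P ∈ monicFactors f ↔ P ∣ f := by
  refine ⟨dvd_of_mem_monicFactors, ?_⟩
  rintro ⟨h, rfl⟩
  rw [monicFactors_mul hP.ne_zero (hm.of_mul_monic_left hf).ne_zero, monicFactors_irreducible hP hm]
  simp

/-- The polynomials all of whose monic irreducible factors lie in `s`. -/
def smoothPolys (s : Finset {P : F[X] // P.Monic ∧ Irreducible P}) : Set F[X] :=
  {f | ∀ Q ∈ monicFactors f, ∃ P ∈ s, P.1 = Q}

/-- A finite Euler product, by induction on the set of primes: the terms `f` divisible by the new
prime `P` are the `P * h` and contribute `c P` times the new sum. -/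
theorem prod_inv_one_sub_eq_tsum_smoothPolys {c : F[X] → ℂ} (hc1 : c 1 = 1)
    (hc0 : ∀ f, ¬ f.Monic → c f = 0)
    (hmul : ∀ P h : F[X], P.Monic → Irreducible P → h.Monic → c (P * h) = c P * c h)
    (hsum : Summable c) (hne : ∀ P : F[X], P.Monic → Irreducible P → c P ≠ 1)
    (s : Finset {P : F[X] // P.Monic ∧ Irreducible P}) :
    ∏ P ∈ s, (1 - c P.1)⁻¹ = ∑' f, (smoothPolys s).indicator c f := by
  classical
  induction s using Finset.induction_on with
  | empty =>
    rw [Finset.prod_empty, tsum_eq_single 1]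
    · rw [Set.indicator_of_mem, hc1]
      intro Q hQ
      simp [monicFactors_one] at hQ
    · intro f hf
      refine Set.indicator_apply_eq_zero.mpr fun hs => hc0 f fun hfm => hf ?_
      have h0 : monicFactors f = 0 := Multiset.eq_zero_of_forall_notMem fun Q hQ => by
        simpa using hs Q hQ
      rw [← prod_monicFactors hfm, h0, Multiset.prod_zero]
  | insert P s hPs ih =>
    obtain ⟨P, hPm, hP⟩ := P
    set S := smoothPolys (insert (⟨P, hPm, hP⟩ : {P : F[X] // P.Monic ∧ Irreducible P}) s) with hS
    have hmemS {f : F[X]} : f ∈ S ↔ ∀ Q ∈ monicFactors f, Q = P ∨ ∃ R ∈ s, R.1 = Q := by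
      simp [hS, smoothPolys, eq_comm]
    have hsplit (f : F[X]) : S.indicator c f =
        (smoothPolys s).indicator c f + {f | P ∣ f}.indicator (S.indicator c) f := by
      by_cases hfm : f.Monic
      · by_cases hd : P ∣ f
        · have hns : f ∉ smoothPolys s := by
            intro hf
            obtain ⟨R, hR, hRP⟩ := hf P ((mem_monicFactors_iff hfm hP hPm).mpr hd)
            exact hPs (by rwa [show R = ⟨P, hPm, hP⟩ from Subtype.ext hRP] at hR)
          rw [Set.indicator_of_notMem hns, Set.indicator_of_mem (s := {f | P ∣ f}) hd, zero_add]
        · have hiff : f ∈ S ↔ f ∈ smoothPolys s := by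
            rw [hmemS]
            refine forall₂_congr fun Q hQ => or_iff_right ?_
            rintro rfl
            exact hd (dvd_of_mem_monicFactors hQ)
          rw [Set.indicator_of_notMem (s := {f | P ∣ f}) hd, add_zero]
          simp only [Set.indicator_apply, hiff]
      · simp [Set.indicator_apply, hc0 f hfm]
    have hmulP (h : F[X]) : S.indicator c (P * h) = c P * S.indicator c h := by
      by_cases hh : h.Monic
      · have hiff : P * h ∈ S ↔ h ∈ S := by
          rw [hmemS, hmemS, monicFactors_mul hP.ne_zero hh.ne_zero, monicFactors_irreducible hP hPm]
          simp
        simp only [Set.indicator_apply, hiff, hmul P h hPm hP hh, mul_ite, mul_zero]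
      · have hh' : ¬ (P * h).Monic := fun h' => hh (hPm.of_mul_monic_left h')
        simp [Set.indicator_apply, hc0 _ hh, hc0 _ hh']
    have hdvd : ∑' f, {f | P ∣ f}.indicator (S.indicator c) f = c P * ∑' f, S.indicator c f := by
      rw [← tsum_mul_left, ← (mul_right_injective₀ hP.ne_zero).tsum_eq]
      · refine tsum_congr fun h => ?_
        rw [Set.indicator_of_mem (s := {f | P ∣ f}) (dvd_mul_right P h), hmulP]
      · intro f hf
        have hPf : f ∈ {f | P ∣ f} := Set.mem_of_indicator_ne_zero hf
        obtain ⟨h, rfl⟩ := hPf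
        exact ⟨h, rfl⟩
    have heq : ∑' f, S.indicator c f =
        ∑' f, (smoothPolys s).indicator c f + c P * ∑' f, S.indicator c f := by
      rw [← hdvd, ← Summable.tsum_add (hsum.indicator _) ((hsum.indicator _).indicator _)]
      exact tsum_congr hsplit
    rw [Finset.prod_insert hPs, ih]
    have h1 : 1 - c P ≠ 0 := sub_ne_zero.mpr (hne P hPm hP).symm
    rw [inv_mul_eq_iff_eq_mul₀ h1]
    linear_combination -heq

theorem hasProd_inv_one_sub {c : F[X] → ℂ} (hc1 : c 1 = 1) (hc0 : ∀ f, ¬ f.Monic → c f = 0)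
    (hmul : ∀ P h : F[X], P.Monic → Irreducible P → h.Monic → c (P * h) = c P * c h)
    (hsum : Summable fun f => ‖c f‖) (hne : ∀ P : F[X], P.Monic → Irreducible P → c P ≠ 1) :
    HasProd (fun P : {P : F[X] // P.Monic ∧ Irreducible P} => (1 - c P.1)⁻¹) (∑' f, c f) := by
  classical
  rw [HasProd, SummationFilter.unconditional_filter]
  simp_rw [prod_inv_one_sub_eq_tsum_smoothPolys hc1 hc0 hmul hsum.of_norm hne]
  refine tendsto_tsum_of_dominated_convergence hsum (fun f => ?_)
    (Eventually.of_forall fun s f => norm_indicator_le_norm_self c f)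
  refine tendsto_const_nhds.congr' ?_
  filter_upwards [eventually_ge_atTop
    ((monicFactors f).toFinset.subtype fun P => P.Monic ∧ Irreducible P)] with s hs
  rw [Set.indicator_of_mem]
  intro Q hQ
  exact ⟨⟨Q, monic_of_mem_monicFactors hQ, irreducible_of_mem_monicFactors hQ⟩,
    hs (by simpa using hQ), rfl⟩

end eulerProduct

/-! ### The `L`-function -/

section LFunction

open Filter Topology

variable {F : Type*} [Field F]

open scoped Classical in
/-- The term of the Dirichlet series of `χ_D` at `f`, extended by zero to all polynomials that are
not monic. -/
noncomputable def lTerm (D : F[X]) (u : ℂ) (f : F[X]) : ℂ :=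
  if f.Monic then chi D f * u ^ f.natDegree else 0

theorem lTerm_of_monic (D : F[X]) (u : ℂ) {f : F[X]} (hf : f.Monic) :
    lTerm D u f = chi D f * u ^ f.natDegree := if_pos hf

theorem norm_intCast_le_one {n : ℤ} (h : |n| ≤ 1) : ‖(n : ℂ)‖ ≤ 1 := by
  rw [Complex.norm_intCast]
  exact_mod_cast h

variable [Finite F]

theorem norm_lt_one_of_lt {u : ℂ} (hu : ‖u‖ < 1 / (Nat.card F : ℝ)) : ‖u‖ < 1 := by
  refine hu.trans_le ?_
  rw [div_le_one (by exact_mod_cast Nat.card_pos)]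
  exact_mod_cast Nat.card_pos

theorem card_mul_norm_lt_one {u : ℂ} (hu : ‖u‖ < 1 / (Nat.card F : ℝ)) :
    (Nat.card F : ℝ) * ‖u‖ < 1 := by
  rwa [lt_div_iff₀ (by exact_mod_cast Nat.card_pos), mul_comm] at hu

open scoped Classical in
theorem summable_monic {r : ℝ} (hr : 0 ≤ r) (h : (Nat.card F : ℝ) * r < 1) :
    Summable fun f : F[X] => if f.Monic then r ^ f.natDegree else 0 := by
  refine summable_of_sum_le (c := (1 - (Nat.card F : ℝ) * r)⁻¹)
    (fun f => by dsimp only; split_ifs <;> positivity) fun s => ?_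
  rw [← Finset.sum_filter]
  have hsub : s.filter Monic ⊆
      (Finset.range (s.sup natDegree + 1)).biUnion fun n => monicOfDegree F n := by
    intro f hf
    rw [Finset.mem_filter] at hf
    rw [Finset.mem_biUnion]
    exact ⟨f.natDegree, Finset.mem_range.mpr (Nat.lt_succ_of_le (Finset.le_sup hf.1)),
      mem_monicOfDegree.mpr ⟨hf.2, rfl⟩⟩
  refine (Finset.sum_le_sum_of_subset_of_nonneg hsub fun _ _ _ => by positivity).trans ?_
  rw [Finset.sum_biUnion]
  · have hn (n : ℕ) : ∑ f ∈ monicOfDegree F n, r ^ f.natDegree = ((Nat.card F : ℝ) * r) ^ n := by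
      rw [Finset.sum_congr rfl (g := fun _ => r ^ n)
        fun f hf => by rw [(mem_monicOfDegree.mp hf).2]]
      simp [card_monicOfDegree, mul_pow]
    simp_rw [hn]
    rw [← tsum_geometric_of_lt_one (by positivity) h]
    exact (summable_geometric_of_lt_one (by positivity) h).sum_le_tsum _
      fun _ _ => by positivity
  · intro m _ n _ hmn
    refine Finset.disjoint_left.mpr fun f hf hf' => hmn ?_
    rw [← (mem_monicOfDegree.mp hf).2, (mem_monicOfDegree.mp hf').2]

theorem summable_norm_lTerm (D : F[X]) {u : ℂ} (hu : ‖u‖ < 1 / (Nat.card F : ℝ)) :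
    Summable fun f => ‖lTerm D u f‖ := by
  classical
  refine Summable.of_nonneg_of_le (fun _ => norm_nonneg _) (fun f => ?_)
    (summable_monic (F := F) (norm_nonneg u) (card_mul_norm_lt_one hu))
  unfold lTerm
  split_ifs
  · rw [norm_mul, norm_pow]
    exact mul_le_of_le_one_left (by positivity) (norm_intCast_le_one (abs_chi_le D f))
  · simp

theorem norm_chi_mul_pow_lt_one (D : F[X]) {u : ℂ} (hu : ‖u‖ < 1 / (Nat.card F : ℝ)) {P : F[X]}
    (hP : Irreducible P) : ‖(chi D P : ℂ) * u ^ P.natDegree‖ < 1 := by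
  rw [norm_mul, norm_pow]
  exact (mul_le_of_le_one_left (by positivity) (norm_intCast_le_one (abs_chi_le D P))).trans_lt
    (pow_lt_one₀ (norm_nonneg u) (norm_lt_one_of_lt hu) hP.natDegree_pos.ne')

theorem hasProd_lTerm (D : F[X]) {u : ℂ} (hu : ‖u‖ < 1 / (Nat.card F : ℝ)) :
    HasProd (fun P : {P : F[X] // P.Monic ∧ Irreducible P} =>
      (1 - (chi D P.1 : ℂ) * u ^ P.1.natDegree)⁻¹) (∑' f, lTerm D u f) := by
  have h := hasProd_inv_one_sub (c := lTerm D u) ?_ (fun f hf => if_neg hf) ?_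
    (summable_norm_lTerm D hu) ?_
  · convert h using 4 with P
    rw [lTerm_of_monic D u P.2.1]
  · rw [lTerm_of_monic D u monic_one]
    simp
  · intro P h hPm hP hh
    rw [lTerm_of_monic D u (hPm.mul hh), lTerm_of_monic D u hPm, lTerm_of_monic D u hh,
      chi_mul D hP.ne_zero hh.ne_zero, hPm.natDegree_mul hh]
    push_cast
    ring
  · intro P hPm hP h1
    have := norm_chi_mul_pow_lt_one D hu hP
    rw [← lTerm_of_monic D u hPm, h1, norm_one] at this
    exact lt_irrefl _ this

theorem hasSum_charSum (D : F[X]) {u : ℂ} (hu : ‖u‖ < 1 / (Nat.card F : ℝ)) :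
    HasSum (fun n => (charSum D n : ℂ) * u ^ n) (∑' f, lTerm D u f) := by
  have hfib (n : ℕ) : ∑' f : (natDegree ⁻¹' {n} : Set F[X]), lTerm D u f.1 =
      (charSum D n : ℂ) * u ^ n := by
    rw [tsum_subtype (natDegree ⁻¹' {n}) (lTerm D u), tsum_eq_sum (s := monicOfDegree F n)]
    · rw [charSum, Int.cast_sum, Finset.sum_mul]
      refine Finset.sum_congr rfl fun f hf => ?_
      obtain ⟨hm, hd⟩ := mem_monicOfDegree.mp hf
      rw [Set.indicator_of_mem (by simpa using hd), lTerm_of_monic D u hm, hd]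
    · intro f hf
      refine Set.indicator_apply_eq_zero.mpr fun hd => if_neg fun hm => hf ?_
      exact mem_monicOfDegree.mpr ⟨hm, hd⟩
  rw [← funext hfib]
  exact (summable_norm_lTerm D hu).of_norm.hasSum.tsum_fiberwise natDegree

/-- The polynomial whose coefficients are the character sums of degree at most `N`. -/
noncomputable def lPolynomial (D : F[X]) (N : ℕ) : ℤ[X] :=
  ∑ n ∈ Finset.range (N + 1), C (charSum D n) * X ^ n

theorem aeval_lPolynomial {A : Type*} [CommRing A] (D : F[X]) (N : ℕ) (u : A) :
    aeval u (lPolynomial D N) = ∑ n ∈ Finset.range (N + 1), (charSum D n : A) * u ^ n := by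
  simp [lPolynomial]

theorem tsum_lTerm (hodd : Odd (Nat.card F)) {D : F[X]} (hD : D.Monic) {g : ℕ}
    (hg : D.natDegree = 2 * g + 1) {u : ℂ} (hu : ‖u‖ < 1 / (Nat.card F : ℝ)) :
    ∑' f, lTerm D u f = aeval u (lPolynomial D (2 * g)) := by
  rw [aeval_lPolynomial]
  refine (hasSum_charSum D hu).unique (hasSum_sum_of_ne_finset_zero fun n hn => ?_)
  rw [Finset.mem_range, not_lt] at hn
  rw [charSum_eq_zero hodd hD ⟨g, hg⟩ (by omega), Int.cast_zero, zero_mul]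

theorem isLPolynomial_lPolynomial (hodd : Odd (Nat.card F)) {D : F[X]} (hD : D.Monic) {g : ℕ}
    (hg : D.natDegree = 2 * g + 1) : IsLPolynomial D (lPolynomial D (2 * g)) := by
  intro u hu
  rw [← tsum_lTerm hodd hD hg hu]
  exact hasProd_lTerm D hu

/-- The power sums attached to the Euler product: `n` times the `n`-th coefficient of
`log L(u, χ_D)`. -/
noncomputable def primePowerSum (D : F[X]) (n : ℕ) : ℤ :=
  ∑ P ∈ primesDvd F n, P.natDegree * chi D P ^ (n / P.natDegree)

theorem hasSum_neg_log {z : ℂ} (hz : ‖z‖ < 1) :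
    HasSum (fun k : ℕ => z ^ (k + 1) / ((k + 1 : ℕ) : ℂ)) (-Complex.log (1 - z)) := by
  have := (hasSum_nat_add_iff' 1).mpr (Complex.hasSum_taylorSeries_neg_log hz)
  simpa using this

/-- The terms in the expansion of the logarithm of the Euler product, indexed by a prime `P` and
an exponent `k + 1`. -/
noncomputable def logTerm (D : F[X]) (u : ℂ)
    (p : {P : F[X] // P.Monic ∧ Irreducible P} × ℕ) : ℂ :=
  ((chi D p.1.1 : ℂ) * u ^ p.1.1.natDegree) ^ (p.2 + 1) / ((p.2 + 1 : ℕ) : ℂ)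

theorem summable_logTerm (D : F[X]) {u : ℂ} (hu : ‖u‖ < 1 / (Nat.card F : ℝ)) :
    Summable (logTerm D u) := by
  classical
  have hu1 := norm_lt_one_of_lt hu
  have h1 : Summable fun P : {P : F[X] // P.Monic ∧ Irreducible P} => ‖u‖ ^ P.1.natDegree := by
    have := (summable_monic (F := F) (norm_nonneg u) (card_mul_norm_lt_one hu)).comp_injective
      (Subtype.val_injective (p := fun P : F[X] => P.Monic ∧ Irreducible P))
    refine this.congr fun P => ?_
    simp [P.2.1]
  have h2 : Summable fun k : ℕ => ‖u‖ ^ k := summable_geometric_of_lt_one (norm_nonneg u) hu1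
  refine Summable.of_norm_bounded (h1.mul_of_nonneg h2 (fun _ => by positivity)
    fun _ => by positivity) ?_
  rintro ⟨⟨P, hPm, hP⟩, k⟩
  rw [logTerm, norm_div, norm_pow, norm_mul, norm_pow, Complex.norm_natCast]
  have hχ := norm_intCast_le_one (abs_chi_le D P)
  have hd := hP.natDegree_pos
  calc (‖(chi D P : ℂ)‖ * ‖u‖ ^ P.natDegree) ^ (k + 1) / ((k + 1 : ℕ) : ℝ)
      ≤ (‖(chi D P : ℂ)‖ * ‖u‖ ^ P.natDegree) ^ (k + 1) :=
        div_le_self (by positivity) (by exact_mod_cast (by omega : 1 ≤ k + 1))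
    _ ≤ (‖u‖ ^ P.natDegree) ^ (k + 1) := by
        gcongr
        exact mul_le_of_le_one_left (by positivity) hχ
    _ = ‖u‖ ^ P.natDegree * ‖u‖ ^ (P.natDegree * k) := by
        rw [pow_succ, ← pow_mul, mul_comm]
    _ ≤ ‖u‖ ^ P.natDegree * ‖u‖ ^ k := by
        gcongr ?_ * ?_
        exact pow_le_pow_of_le_one (norm_nonneg u) hu1.le (Nat.le_mul_of_pos_left k hd)

/-- The pairs `(P, k)` with `(k + 1) * deg P = n + 1` correspond to the primes whose degree
divides `n + 1`. -/
theorem tsum_logTerm_fiber (D : F[X]) (u : ℂ) (n : ℕ) :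
    ∑' p : (fun p : {P : F[X] // P.Monic ∧ Irreducible P} × ℕ =>
        (p.2 + 1) * p.1.1.natDegree - 1) ⁻¹' {n}, logTerm D u p =
      (primePowerSum D (n + 1) : ℂ) * u ^ (n + 1) / ((n + 1 : ℕ) : ℂ) := by
  have hfib (p : {P : F[X] // P.Monic ∧ Irreducible P} × ℕ) :
      (p.2 + 1) * p.1.1.natDegree - 1 = n ↔ (p.2 + 1) * p.1.1.natDegree = n + 1 := by
    have : 0 < (p.2 + 1) * p.1.1.natDegree := Nat.mul_pos p.2.succ_pos p.1.2.2.natDegree_pos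
    omega
  let e : ((fun p : {P : F[X] // P.Monic ∧ Irreducible P} × ℕ =>
      (p.2 + 1) * p.1.1.natDegree - 1) ⁻¹' {n}) → primesDvd F (n + 1) := fun p =>
    ⟨p.1.1.1, (mem_primesDvd n.succ_ne_zero).mpr
      ⟨p.1.1.2.1, p.1.1.2.2, ⟨p.1.2 + 1, ((hfib p.1).mp p.2).symm.trans (mul_comm _ _)⟩⟩⟩
  have he : Function.Bijective e := by
    constructor
    · rintro ⟨⟨P, k⟩, hp⟩ ⟨⟨Q, l⟩, hq⟩ h
      have h0 : P.1 = Q.1 := congrArg (fun R => R.1) h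
      obtain rfl : P = Q := Subtype.ext h0
      have h1 := (hfib _).mp hp
      have h2 := (hfib _).mp hq
      have h3 : k + 1 = l + 1 := Nat.eq_of_mul_eq_mul_right P.2.2.natDegree_pos (h1.trans h2.symm)
      obtain rfl : k = l := Nat.succ.inj h3
      rfl
    · rintro ⟨P, hP⟩
      obtain ⟨hm, hirr, k, hk⟩ := (mem_primesDvd n.succ_ne_zero).mp hP
      have hk0 : k ≠ 0 := by rintro rfl; simp at hk
      refine ⟨⟨(⟨P, hm, hirr⟩, k - 1), ?_⟩, rfl⟩
      refine (hfib _).mpr ?_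
      dsimp only
      rw [Nat.sub_add_cancel (Nat.one_le_iff_ne_zero.mpr hk0), mul_comm, ← hk]
  rw [primePowerSum, Int.cast_sum, Finset.sum_mul, Finset.sum_div,
    ← Finset.tsum_subtype (primesDvd F (n + 1)) fun P =>
      (((P.natDegree : ℤ) * chi D P ^ ((n + 1) / P.natDegree) : ℤ) : ℂ) * u ^ (n + 1) /
        ((n + 1 : ℕ) : ℂ), ← (Equiv.ofBijective e he).tsum_eq]
  refine tsum_congr ?_
  rintro ⟨⟨⟨P, hm, hP⟩, k⟩, hp⟩
  have h1 : (k + 1) * P.natDegree = n + 1 := (hfib _).mp hp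
  have hd : (P.natDegree : ℂ) ≠ 0 := by exact_mod_cast hP.natDegree_pos.ne'
  have hk : ((k + 1 : ℕ) : ℂ) ≠ 0 := by exact_mod_cast k.succ_ne_zero
  simp only [Equiv.ofBijective_apply, e, logTerm]
  rw [← h1, Nat.mul_div_cancel _ hP.natDegree_pos, mul_pow, ← pow_mul, mul_comm P.natDegree]
  push_cast at hk ⊢
  field_simp

/-- The logarithm of the `L`-function, expanded as a power series in `u`. -/
theorem exists_hasSum_primePowerSum (D : F[X]) {u : ℂ} (hu : ‖u‖ < 1 / (Nat.card F : ℝ)) :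
    ∃ A : ℂ, Complex.exp A = ∑' f, lTerm D u f ∧
      HasSum (fun n : ℕ => (primePowerSum D (n + 1) : ℂ) * u ^ (n + 1) / ((n + 1 : ℕ) : ℂ)) A := by
  have hsum := (summable_logTerm D hu).hasSum
  refine ⟨∑' p, logTerm D u p, ?_, ?_⟩
  · have hlog (P : {P : F[X] // P.Monic ∧ Irreducible P}) : HasSum (fun k => logTerm D u (P, k))
        (-Complex.log (1 - (chi D P.1 : ℂ) * u ^ P.1.natDegree)) := by
      have h1 : ‖(chi D P.1 : ℂ) * u ^ P.1.natDegree‖ < 1 := norm_chi_mul_pow_lt_one D hu P.2.2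
      have h2 := hasSum_neg_log h1
      simpa only [logTerm] using h2
    have h := hsum.prod_fiberwise hlog
    refine h.cexp.unique ?_
    convert hasProd_lTerm D hu using 2 with P
    have hne : 1 - (chi D P.1 : ℂ) * u ^ P.1.natDegree ≠ 0 := by
      intro h0
      have := norm_chi_mul_pow_lt_one D hu P.2.2
      rw [← sub_eq_zero.mp h0, norm_one] at this
      exact lt_irrefl _ this
    rw [Function.comp_apply, Complex.exp_neg, Complex.exp_log hne]
  · rw [← funext (tsum_logTerm_fiber D u)]
    exact hsum.tsum_fiberwise fun p => (p.2 + 1) * p.1.1.natDegree - 1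

end LFunction


/-! ### The numerator of the zeta function and the central value -/

section zeta

variable {F : Type*} [Field F] [Finite F]

theorem one_sub_ne_zero_of_norm_lt_one {z : ℂ} (hz : ‖z‖ < 1) : 1 - z ≠ 0 := by
  intro h
  rw [← sub_eq_zero.mp h, norm_one] at hz
  exact lt_irrefl _ hz

theorem norm_card_mul_lt_one {u : ℂ} (hu : ‖u‖ < 1 / (Nat.card F : ℝ)) :
    ‖(Nat.card F : ℂ) * u‖ < 1 := by
  rw [norm_mul, Complex.norm_natCast]
  exact card_mul_norm_lt_one hu

theorem isZetaNumerator_lPolynomial (hodd : Odd (Nat.card F)) {D : F[X]} (hD : D.Monic) {g : ℕ}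
    (hg : D.natDegree = 2 * g + 1) : IsZetaNumerator g D (lPolynomial D (2 * g)) := by
  intro u hu
  obtain ⟨A, hA, hsum⟩ := exists_hasSum_primePowerSum D hu
  have h1 := one_sub_ne_zero_of_norm_lt_one (norm_lt_one_of_lt hu)
  have h2 := one_sub_ne_zero_of_norm_lt_one (norm_card_mul_lt_one hu)
  have hterm (n : ℕ) : zetaTerm g D u n =
      u ^ (n + 1) / ((n + 1 : ℕ) : ℂ) + ((Nat.card F : ℂ) * u) ^ (n + 1) / ((n + 1 : ℕ) : ℂ) +
        (primePowerSum D (n + 1) : ℂ) * u ^ (n + 1) / ((n + 1 : ℕ) : ℂ) := by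
    have h : ((pointCount g D (n + 1) : ℤ) : ℂ) = _ :=
      congrArg Int.cast (pointCount_eq hodd hg (n + 1))
    rw [Int.cast_natCast] at h
    rw [zetaTerm, h, ← primePowerSum]
    push_cast
    ring
  have hz : HasSum (zetaTerm g D u)
      (-Complex.log (1 - u) + -Complex.log (1 - (Nat.card F : ℂ) * u) + A) := by
    rw [funext hterm]
    exact ((hasSum_neg_log (norm_lt_one_of_lt hu)).add
      (hasSum_neg_log (norm_card_mul_lt_one hu))).add hsum
  refine ⟨hz.summable, ?_⟩
  rw [hz.tsum_eq, Complex.exp_add, Complex.exp_add, Complex.exp_neg, Complex.exp_neg,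
    Complex.exp_log h1, Complex.exp_log h2, hA, tsum_lTerm hodd hD hg hu]
  field_simp

theorem eq_of_aeval_eq_on_ball {P Q : ℤ[X]} {r : ℝ} (hr : 0 < r)
    (h : ∀ u : ℂ, ‖u‖ < r → aeval u P = aeval u Q) : P = Q := by
  apply map_injective (Int.castRingHom ℂ) (RingHom.injective_int _)
  refine eq_of_infinite_eval_eq _ _ ?_
  refine (infinite_of_mem_nhds (0 : ℂ) (Metric.ball_mem_nhds 0 hr)).mono fun u hu => ?_
  have := h u (by simpa using hu)
  simpa [aeval_def, eval_map] using this

theorem IsZetaNumerator.unique {g : ℕ} {D : F[X]} {P Q : ℤ[X]} (hP : IsZetaNumerator g D P)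
    (hQ : IsZetaNumerator g D Q) : P = Q := by
  refine eq_of_aeval_eq_on_ball (r := 1 / (Nat.card F : ℝ))
    (one_div_pos.mpr (by exact_mod_cast Nat.card_pos)) fun u hu => ?_
  have h1 := one_sub_ne_zero_of_norm_lt_one (norm_lt_one_of_lt hu)
  have h2 := one_sub_ne_zero_of_norm_lt_one (norm_card_mul_lt_one hu)
  exact (div_left_inj' (mul_ne_zero h1 h2)).mp ((hP u hu).2.symm.trans (hQ u hu).2)

theorem IsLPolynomial.unique {D : F[X]} {P Q : ℤ[X]} (hP : IsLPolynomial D P)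
    (hQ : IsLPolynomial D Q) : P = Q :=
  eq_of_aeval_eq_on_ball (r := 1 / (Nat.card F : ℝ))
    (one_div_pos.mpr (by exact_mod_cast Nat.card_pos)) fun u hu => (hP u hu).unique (hQ u hu)

/-- At the centre of symmetry the upper half of the coefficients repeats the lower half. -/
theorem aeval_lPolynomial_central (hodd : Odd (Nat.card F)) {D : F[X]} (hD : D.Monic)
    (hs : Squarefree D) {g : ℕ} (hg : D.natDegree = 2 * g + 1) {x : ℝ}
    (hx : (Nat.card F : ℝ) * x ^ 2 = 1) :
    aeval x (lPolynomial D (2 * g)) =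
      ∑ n ∈ Finset.range (g + 1), (charSum D n : ℝ) * x ^ n +
        ∑ m ∈ Finset.range g, (charSum D m : ℝ) * x ^ m := by
  have hq : (Nat.card F : ℝ) ≠ 0 := by exact_mod_cast Nat.card_pos.ne'
  rw [aeval_lPolynomial, show 2 * g + 1 = g + 1 + g by omega, Finset.sum_range_add]
  congr 1
  rw [← Finset.sum_range_reflect]
  refine Finset.sum_congr rfl fun m hm => ?_
  have hm := Finset.mem_range.mp hm
  have hsymm := charSum_symm hodd hD hs hg (k := m) (by omega)
  rw [show g + 1 + (g - 1 - m) = 2 * g - m by omega]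
  obtain ⟨j, rfl⟩ := Nat.exists_eq_add_of_le hm.le
  have hc : (charSum D (2 * (m + j) - m) : ℝ) = (Nat.card F : ℝ) ^ j * charSum D m := by
    apply mul_left_cancel₀ (pow_ne_zero m hq)
    rw [← mul_assoc, ← pow_add]
    exact_mod_cast hsymm.symm
  have hp : (Nat.card F : ℝ) ^ j * (x ^ 2) ^ j = 1 := by rw [← mul_pow, hx, one_pow]
  have hpow : x ^ (2 * (m + j) - m) = x ^ m * (x ^ 2) ^ j := by
    rw [← pow_mul, ← pow_add]
    congr 1
    omega
  rw [hc, hpow]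
  linear_combination (charSum D m : ℝ) * x ^ m * hp

theorem charSum_mul_pow (D : F[X]) (n : ℕ) :
    (charSum D n : ℝ) * ((Nat.card F : ℝ) ^ (-(1 / 2) : ℝ)) ^ n =
      ∑ f ∈ monicOfDegree F n, (chi D f : ℝ) * (Nat.card F : ℝ) ^ (-(n : ℝ) / 2) := by
  rw [charSum, Int.cast_sum, Finset.sum_mul, ← Real.rpow_natCast,
    ← Real.rpow_mul (Nat.cast_nonneg _)]
  refine Finset.sum_congr rfl fun f _ => ?_
  congr 2
  ring

end zeta

end HyperellipticL


theorem mainTheorem5 {F : Type*} [Field F] [Finite F] (hq : Odd (Nat.card F)) (g : ℕ)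
    (D : F[X]) (hD : D ∈ HyperellipticL.ensemble F g) :
    (∃! P : ℤ[X], HyperellipticL.IsZetaNumerator g D P) ∧
    (∃! L : ℤ[X], HyperellipticL.IsLPolynomial D L) ∧
    ∀ P L : ℤ[X], HyperellipticL.IsZetaNumerator g D P → HyperellipticL.IsLPolynomial D L →
      aeval ((Nat.card F : ℝ) ^ (-(1 / 2) : ℝ)) P = aeval ((Nat.card F : ℝ) ^ (-(1 / 2) : ℝ)) L ∧
      aeval ((Nat.card F : ℝ) ^ (-(1 / 2) : ℝ)) L =
        ∑ n ∈ Finset.range (g + 1), ∑ f ∈ HyperellipticL.monicOfDegree F n,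
            (HyperellipticL.chi D f : ℝ) * (Nat.card F : ℝ) ^ (-(n : ℝ) / 2) +
          ∑ m ∈ Finset.range g, ∑ f ∈ HyperellipticL.monicOfDegree F m,
            (HyperellipticL.chi D f : ℝ) * (Nat.card F : ℝ) ^ (-(m : ℝ) / 2) := by
  obtain ⟨hm, hdeg, hs⟩ := hD
  have hZ := HyperellipticL.isZetaNumerator_lPolynomial hq hm hdeg
  have hL := HyperellipticL.isLPolynomial_lPolynomial hq hm hdeg
  refine ⟨⟨_, hZ, fun P hP => hP.unique hZ⟩, ⟨_, hL, fun L hL' => hL'.unique hL⟩, ?_⟩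
  intro P L hP hL'
  rw [hP.unique hZ, hL'.unique hL]
  refine ⟨rfl, ?_⟩
  have hx : (Nat.card F : ℝ) * ((Nat.card F : ℝ) ^ (-(1 / 2) : ℝ)) ^ 2 = 1 := by
    have hpos : (0 : ℝ) < Nat.card F := by exact_mod_cast Nat.card_pos
    rw [← Real.rpow_natCast, ← Real.rpow_mul hpos.le]
    norm_num
    rw [Real.rpow_neg_one, mul_inv_cancel₀ hpos.ne']
  rw [HyperellipticL.aeval_lPolynomial_central hq hm hs hdeg hx]
  simp_rw [HyperellipticL.charSum_mul_pow]
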